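/- Let $q_0$ be a prime power, let $m,s,\ell$ be positive integers, $q=q_0^s$, $n=\ell m$, and assume that $\ell$ is coprime to $m$ and to $q$ and that $\ell\mid q-1$. Put $\mathbb F=\mathbb F_{q_0^m}$, regarded like $\mathbb F_q$ as a subfield of $\mathbb F_{q^m}$, and let $\sigma$ denote $x\mapsto x^q$. **Cyclic-skew-cyclic codes.** Write $c\in\mathbb F^n$ as $c=(c^{(0)},\dots,c^{(\ell-1)})$ with $c^{(i)}=(c^{(i)}_0,\dots,c^{(i)}_{m-1})\in\mathbb F^m$. An $\mathbb F$-linear code $\mathcal C\subseteq\mathbb F^n$ is a CSC code if it is closed under $(c^{(0)},\dots,c^{(\ell-1)})\mapsto(c^{(\ell-1)},c^{(0)},\dots,c^{(\ell-2)})$ and under applying $(c_0,\dots,c_{m-1})\mapsto(\sigma(c_{m-1}),\sigma(c_0),\dots,\sigma(c_{m-2}))$ to every block. Let $\mathcal S=\mathbb F[x]/(x^\ell-1)$, let $\sigma$ act on $\mathcal S$ with $\sigma(x)=x$, let $\mathcal S[z;\sigma]$ be the skew polynomial ring ($zr=\sigma(r)z$), and let $\mathcal R=\mathcal S[z;\sigma]/(z^m-1)$.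 Identify $c$ with $\sum_{j=0}^{m-1}\bigl(\sum_{i=0}^{\ell-1}c^{(i)}_jx^i\bigr)z^j\in\mathcal R$. A minimal generator skew polynomial of $\mathcal C$ is a $g\in\mathcal S[z;\sigma]$ such that $\mathcal C$ is the left ideal of $\mathcal R$ generated by $g$ and such that $gh=hg=z^m-1$ for some $h\in\mathcal S[z;\sigma]$, where the projections of $g$ and $h$ modulo every irreducible factor of $x^\ell-1$ in $\mathbb F[x]$ are monic in $z$. If $\mathcal C$ has a unique minimal generator skew polynomial $g$, define, for $\alpha\in\mathbb F_q$ with $\alpha^\ell=1$, $$T_{\mathcal C}(\alpha)=\{\gamma\in\mathbb F_{q^m}\setminus\{0\}\mid g(\alpha,z)\in\mathbb F_{q^m}[z;\sigma]\,(z-\sigma(\gamma)\gamma^{-1})\}$$ (the partial defining set of $\mathcal C$ at $\alpha$), where $g(\alpha,z)$ is obtained by substituting $x=\alpha$ in the coefficients of $g$. **The SR-BCH code.** Let $a\in\mathbb F_q$ be a primitive $\ell$th root of unity, let $\beta\in\mathbb F_{q^m}$ be a normal element of $\mathbb F_{q^m}/\mathbb F_q$ (that is, $\beta,\sigma(\beta),\dots,\sigma^{m-1}(\beta)$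 is a basis of $\mathbb F_{q^m}$ over $\mathbb F_q$), and let $b\ge 0$ and $2\le\delta\le n$ be integers. Let $\mathcal D\subseteq\mathbb F_{q^m}^n$ be the linearized Reed-Solomon code with $\mathcal A=\{1,a,\dots,a^{\ell-1}\}$ and $\mathcal B_i=\{\sigma^j(\beta)a^{bi}\mid 0\le j<m\}$, that is, the $\mathbb F_{q^m}$-span of the $\delta-1$ rows indexed by $k=0,\dots,\delta-2$, the $k$th of which has in block $i$, position $j$, the entry $\sigma^k(\sigma^j(\beta)a^{bi})\prod_{t=0}^{k-1}\sigma^t(a^i)$. Put $\mathcal C_\delta(a^b,\beta)=\mathcal D^\perp\cap\mathbb F^n$, the dual being taken with respect to the standard dot product. **Theorem.** Let $x^\ell-1=m_1(x)\cdots m_t(x)$ be the factorization into irreducible polynomials in $\mathbb F[x]$, and let $d_i=\deg m_i$. For each $i$ let $$\mathcal J_i=\{j\in\mathbb N\mid 0\le j\le\delta-2,\ m_i(a^{b+j})=0\}=\{j_1,\dots,j_{k_i}\},$$ and, whenever $\mathcal J_i\ne\varnothing$, choose an arbitrary $\widetilde j_i\in\mathcal J_i$. Then $d_i\mid s$ for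 all $i$, and for each $i$ there are integers $h_1,\dots,h_{k_i}$ with $0\le h_\lambda\le d_i-1$ and $$b+\widetilde j_i\equiv(b+j_\lambda)\,q_0^{h_\lambda m}\pmod\ell\qquad(\lambda=1,\dots,k_i).$$ For any such integers let $$\mathcal V_i=\Bigl\langle \beta^{q_0^v}\;\Big|\; v=\bigl(s j_\lambda+m(ud_i+h_\lambda)\bigr)\bmod sm,\ 0\le u\le \tfrac{s}{d_i}-1,\ 1\le\lambda\le k_i\Bigr\rangle_{\mathbb F_q}\subseteq\mathbb F_{q^m}$$ (so $\mathcal V_i=\{0\}$ if $\mathcal J_i=\varnothing$). Then $\mathcal C_\delta(a^b,\beta)$ is a CSC code with a unique minimal generator skew polynomial, and: 1. $T_{\mathcal C_\delta(a^b,\beta)}(a^{b+\widetilde j_i})=\mathcal V_i\setminus\{0\}$ for every $i$ with $\mathcal J_i\neq\varnothing$; 2. $\dim_{\mathbb F}\mathcal C_\delta(a^b,\beta)=n-\sum_{i=1}^t d_i\,\dim_{\mathbb F_q}\mathcal V_i$. -/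

import Mathlib

open Polynomial

noncomputable section

namespace SumRankBCH

/-! ### Skew polynomial rings -/

/-- A copy of the commutative ring `R` which remembers a ring endomorphism `σ`; the generator of
`Multiplicative ℕ` acts on it as `σ`, as Mathlib's `SkewPolynomial` requires. -/
def Twist {R : Type*} [CommRing R] (_σ : R →+* R) : Type _ := R

section Twist

variable {R : Type*} [CommRing R] (σ : R →+* R)

instance : CommRing (Twist σ) := inferInstanceAs (CommRing R)

/-- The identity map `R → Twist σ`. -/
def Twist.of : R ≃+* Twist σ := RingEquiv.refl R

instance : MulSemiringAction (Multiplicative ℕ) (Twist σ) where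
  smul k r := Twist.of σ (σ^[k.toAdd] ((Twist.of σ).symm r))
  one_smul _ := rfl
  mul_smul k l r := by
    change σ^[k.toAdd + l.toAdd] _ = σ^[k.toAdd] (σ^[l.toAdd] _)
    rw [Function.iterate_add_apply]
  smul_zero k := iterate_map_zero σ _
  smul_add k r r' := iterate_map_add σ _ _ _
  smul_one k := iterate_map_one σ _
  smul_mul k r r' := iterate_map_mul σ _ _ _

end Twist

/-- The skew polynomial ring `R[z; σ]`, in which `z * r = σ(r) * z`. -/
abbrev SkewPoly {R : Type*} [CommRing R] (σ : R →+* R) : Type _ := SkewPolynomial (Twist σ)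

/-- The defining commutation rule of `R[z; σ]`. -/
theorem SkewPoly.X_mul_C {R : Type*} [CommRing R] (σ : R →+* R) (r : R) :
    (SkewPolynomial.X * SkewPolynomial.C (Twist.of σ r) : SkewPoly σ) =
      SkewPolynomial.C (Twist.of σ (σ r)) * SkewPolynomial.X := by
  rw [← SkewPolynomial.monomial_zero_left, ← SkewPolynomial.monomial_zero_left,
    SkewPolynomial.X_mul_monomial, SkewPolynomial.monomial_mul_X]
  rfl

/-- The coefficient of `z ^ k`. -/
def SkewPoly.coeff {R : Type*} [CommRing R] {σ : R →+* R} (f : SkewPoly σ) (k : ℕ) : R :=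
  (Twist.of σ).symm (SkewPolynomial.coeff f k)

/-- The monomial `r z ^ k`. -/
def SkewPoly.monomial {R : Type*} [CommRing R] (σ : R →+* R) (k : ℕ) (r : R) : SkewPoly σ :=
  SkewPolynomial.monomial k (Twist.of σ r)

/-- Apply a ring homomorphism to every coefficient. -/
def SkewPoly.map {R R' : Type*} [CommRing R] [CommRing R'] {σ : R →+* R} (σ' : R' →+* R')
    (π : R →+* R') (f : SkewPoly σ) : SkewPoly σ' :=
  ∑ k ∈ SkewPolynomial.support f, SkewPoly.monomial σ' k (π (f.coeff k))

/-- After `π` is applied to its coefficients, `f` is monic in `z`. -/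
def SkewPoly.IsMonicAlong {R R' : Type*} [CommRing R] [CommRing R'] {σ : R →+* R}
    (π : R →+* R') (f : SkewPoly σ) : Prop :=
  ∃ d : ℕ, π (f.coeff d) = 1 ∧ ∀ k, d < k → π (f.coeff k) = 0

/-! ### The automorphism `σ` -/

/-- `σ : x ↦ x ^ q` with `q = q₀ ^ s` and `q₀ = |F₀|`, on an algebra `K` over the finite
field `F₀`. -/
def sigma (F₀ : Type*) [Field F₀] [Fintype F₀] (s : ℕ) (K : Type*) [CommRing K] [Algebra F₀ K] :
    K →+* K :=
  ((FiniteField.frobeniusAlgHom F₀ K) ^ s : K →ₐ[F₀] K).toRingHom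

theorem sigma_apply (F₀ : Type*) [Field F₀] [Fintype F₀] (s : ℕ) (K : Type*) [CommRing K]
    [Algebra F₀ K] (x : K) : sigma F₀ s K x = x ^ (Fintype.card F₀ ^ s) := by
  change ((FiniteField.frobeniusAlgHom F₀ K) ^ s) x = _
  rw [AlgHom.coe_pow, FiniteField.coe_frobeniusAlgHom, pow_iterate]

/-! ### The rings `𝒮 = F[x]/(x ^ ℓ - 1)` and `ℛ = 𝒮[z; σ]/(z ^ N - 1)` -/

/-- `𝒮 = F[x]/(x ^ ℓ - 1)`. -/
abbrev CycRing (F : Type*) [Field F] (ℓ : ℕ) : Type _ := AdjoinRoot (X ^ ℓ - 1 : F[X])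

/-- The extension of `σ : F → F` to `𝒮` with `σ(x) = x`. -/
def cycSigma {F : Type*} [Field F] (σ : F →+* F) (ℓ : ℕ) : CycRing F ℓ →+* CycRing F ℓ :=
  AdjoinRoot.map σ (X ^ ℓ - 1) (X ^ ℓ - 1) (by simp)

/-- The projection `𝒮 → F[x]/(μ)` for a divisor `μ` of `x ^ ℓ - 1`. -/
def cycProj {F : Type*} [Field F] {ℓ : ℕ} (μ : F[X]) (h : μ ∣ X ^ ℓ - 1) :
    CycRing F ℓ →+* AdjoinRoot μ :=
  AdjoinRoot.map (RingHom.id F) (X ^ ℓ - 1) μ (by simpa using h)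

/-- Evaluation `𝒮 → L` at an `ℓ`th root of unity `α` in an extension `L` of `F`. -/
def cycEval {F L : Type*} [Field F] [Field L] [Algebra F L] {ℓ : ℕ} (α : L) (h : α ^ ℓ = 1) :
    CycRing F ℓ →+* L :=
  AdjoinRoot.lift (algebraMap F L) α (by simp [h])

/-- `ℛ = 𝒮[z; σ]/(z ^ N - 1)`, as a left module over `𝒮[z; σ]`. -/
abbrev CSCRing {F : Type*} [Field F] (σ : F →+* F) (ℓ N : ℕ) : Type _ :=
  SkewPoly (cycSigma σ ℓ) ⧸
    Ideal.span {(SkewPolynomial.X ^ N - 1 : SkewPoly (cycSigma σ ℓ))}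

/-- The class in `ℛ` of a skew polynomial in `𝒮[z; σ]`. -/
def toCSCRing {F : Type*} [Field F] (σ : F →+* F) (ℓ N : ℕ) :
    SkewPoly (cycSigma σ ℓ) →ₗ[SkewPoly (cycSigma σ ℓ)] CSCRing σ ℓ N :=
  Submodule.mkQ _

/-! ### Cyclic-skew-cyclic codes

Vectors `(c^{(0)}, …, c^{(ℓ-1)}) ∈ K^n`, `n = ℓ N`, are functions `c : Fin ℓ × Fin N → K`
with `c (i, j) = c^{(i)}_j`. -/

/-- `ν(c) = ∑_j (∑_i c^{(i)}_j x ^ i) z ^ j ∈ ℛ`. -/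
def nu {F : Type*} [Field F] (σ : F →+* F) {ℓ N : ℕ} (c : Fin ℓ × Fin N → F) :
    CSCRing σ ℓ N :=
  toCSCRing σ ℓ N (∑ j : Fin N, SkewPoly.monomial (cycSigma σ ℓ) j
    (AdjoinRoot.mk (X ^ ℓ - 1) (∑ i : Fin ℓ, C (c (i, j)) * X ^ (i : ℕ))))

/-- The inter-block shift: the `i`th block of the image is the `(i-1)`st block, cyclically. -/
def interShift {K : Type*} {ℓ N : ℕ} (c : Fin ℓ × Fin N → K) : Fin ℓ × Fin N → K :=
  fun ij => c ((finRotate ℓ).symm ij.1, ij.2)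

/-- The intra-block shift: `(c_0, …, c_{N-1}) ↦ (σ(c_{N-1}), σ(c_0), …, σ(c_{N-2}))` in every
block. -/
def intraShift {K : Type*} [Field K] (σ : K →+* K) {ℓ N : ℕ} (c : Fin ℓ × Fin N → K) :
    Fin ℓ × Fin N → K :=
  fun ij => σ (c (ij.1, (finRotate N).symm ij.2))

/-- Cyclic-skew-cyclic codes. -/
def IsCSC {K : Type*} [Field K] (σ : K →+* K) {ℓ N : ℕ} (C : Submodule K (Fin ℓ × Fin N → K)) :
    Prop :=
  ∀ c ∈ C, interShift c ∈ C ∧ intraShift σ c ∈ C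

/-- `g ∈ 𝒮[z; σ]` is a minimal generator skew polynomial of `C`: the code is the left ideal of `ℛ`
generated by `g`, and there is `h ∈ 𝒮[z; σ]` with `g h = h g = z ^ N - 1`, where the projections of
`g` and `h` modulo every irreducible factor of `x ^ ℓ - 1` are monic in `z`. -/
def IsMinimalGenerator {F : Type*} [Field F] (σ : F →+* F) {ℓ N : ℕ}
    (C : Submodule F (Fin ℓ × Fin N → F)) (g : SkewPoly (cycSigma σ ℓ)) : Prop :=
  nu σ '' (C : Set (Fin ℓ × Fin N → F)) =
      (Submodule.span (SkewPoly (cycSigma σ ℓ)) {toCSCRing σ ℓ N g} : Set (CSCRing σ ℓ N)) ∧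
    ∃ h : SkewPoly (cycSigma σ ℓ),
      g * h = SkewPolynomial.X ^ N - 1 ∧ h * g = SkewPolynomial.X ^ N - 1 ∧
      ∀ (μ : F[X]) (hμ : μ ∣ X ^ ℓ - 1), Irreducible μ →
        g.IsMonicAlong (cycProj μ hμ) ∧ h.IsMonicAlong (cycProj μ hμ)

open Classical in
/-- The minimal generator skew polynomial of `C` (`0` if there is none). -/
def minimalGenerator {F : Type*} [Field F] (σ : F →+* F) {ℓ N : ℕ}
    (C : Submodule F (Fin ℓ × Fin N → F)) : SkewPoly (cycSigma σ ℓ) :=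
  if h : ∃ g, IsMinimalGenerator σ C g then h.choose else 0

/-! ### Evaluations and defining sets -/

/-- The total evaluation map at `(α, β)`: substitute `x = α` in the coefficients and project
`L[z; σ]` onto its left module quotient `L[z; σ]/(z - σ(β) β⁻¹)`. -/
def totalEval {F L : Type*} [Field F] [Field L] [Algebra F L] {σ : F →+* F} (σL : L →+* L)
    {ℓ : ℕ} (α : L) (hα : α ^ ℓ = 1) (β : L) (f : SkewPoly (cycSigma σ ℓ)) :
    SkewPoly σL ⧸ Ideal.span {(SkewPolynomial.X -
      SkewPolynomial.C (Twist.of σL (σL β * β⁻¹)) : SkewPoly σL)} :=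
  Submodule.Quotient.mk (SkewPoly.map σL (cycEval α hα) f)

/-- The defining set `T_C ⊆ F_q × (L ∖ {0})` of a cyclic-skew-cyclic code. -/
def definingSet {F : Type*} (Fq L : Type*) [Field F] [Field Fq] [Field L] [Algebra F L]
    [Algebra Fq L] (σ : F →+* F) (σL : L →+* L) {ℓ N : ℕ}
    (C : Submodule F (Fin ℓ × Fin N → F)) : Set (Fq × L) :=
  {p | p.2 ≠ 0 ∧ ∃ h : (algebraMap Fq L p.1) ^ ℓ = 1,
    totalEval σL (algebraMap Fq L p.1) h p.2 (minimalGenerator σ C) = 0}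

/-- `T_C(a) = {β ∈ L ∖ {0} | (a, β) ∈ T_C}`. -/
def partialDefiningSet {F Fq : Type*} (L : Type*) [Field F] [Field Fq] [Field L] [Algebra F L]
    [Algebra Fq L] (σ : F →+* F) (σL : L →+* L) {ℓ N : ℕ}
    (C : Submodule F (Fin ℓ × Fin N → F)) (a : Fq) : Set L :=
  {β | (a, β) ∈ definingSet Fq L σ σL C}

/-! ### Linearized Reed-Solomon codes and sum-rank BCH codes -/

/-- `𝒟_a^k(b) = σ^k(b) N_k(a)`, with `N_k(a) = σ^{k-1}(a) ⋯ σ(a) a`. -/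
def linOp {L : Type*} [Field L] (σ : L →+* L) (a : L) (k : ℕ) (b : L) : L :=
  σ^[k] b * ∏ t ∈ Finset.range k, σ^[t] a

/-- The matrix `D(𝒜, ℬ) ∈ L^{k × n}`. -/
def linRSMatrix {L : Type*} [Field L] (σ : L →+* L) {ℓ N : ℕ} (k : ℕ) (A : Fin ℓ → L)
    (B : Fin ℓ → Fin N → L) : Matrix (Fin k) (Fin ℓ × Fin N) L :=
  Matrix.of fun t ij => linOp σ (A ij.1) t (B ij.1 ij.2)

/-- The linearized Reed-Solomon code generated by the rows of `D(𝒜, ℬ)`. -/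
def linRSCode {L : Type*} [Field L] (σ : L →+* L) {ℓ N : ℕ} (k : ℕ) (A : Fin ℓ → L)
    (B : Fin ℓ → Fin N → L) : Submodule L (Fin ℓ × Fin N → L) :=
  Submodule.span L (Set.range (linRSMatrix σ k A B).row)

/-- The dual code. -/
def dualCode {L ι : Type*} [Field L] [Fintype ι] (D : Submodule L (ι → L)) :
    Submodule L (ι → L) where
  carrier := {c | ∀ x ∈ D, x ⬝ᵥ c = 0}
  zero_mem' := by simp
  add_mem' := by
    intro c c' hc hc' x hx
    rw [dotProduct_add, hc x hx, hc' x hx, add_zero]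
  smul_mem' := by
    intro r c hc x hx
    rw [dotProduct_smul, hc x hx, smul_zero]

/-- The subfield subcode `D ∩ F^n`. -/
def subfieldSubcode (F : Type*) {L ι : Type*} [Field F] [Field L] [Algebra F L]
    (D : Submodule L (ι → L)) : Submodule F (ι → F) where
  carrier := {c | (fun i => algebraMap F L (c i)) ∈ D}
  zero_mem' := by
    have h : (fun i => algebraMap F L ((0 : ι → F) i)) = 0 := by ext; simp
    change (fun i => algebraMap F L ((0 : ι → F) i)) ∈ D
    rw [h]
    exact D.zero_mem
  add_mem' := by
    intro c c' hc hc'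
    have h : (fun i => algebraMap F L ((c + c') i)) =
        (fun i => algebraMap F L (c i)) + fun i => algebraMap F L (c' i) := by ext; simp
    change (fun i => algebraMap F L ((c + c') i)) ∈ D
    rw [h]
    exact D.add_mem hc hc'
  smul_mem' := by
    intro r c hc
    have h : (fun i => algebraMap F L ((r • c) i)) =
        algebraMap F L r • fun i => algebraMap F L (c i) := by ext; simp
    change (fun i => algebraMap F L ((r • c) i)) ∈ D
    rw [h]
    exact D.smul_mem _ hc

/-- `β` is a normal element of `F_q ⊆ L`: `β, σ(β), …, σ^{m-1}(β)` is a basis of `L` over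
`F_q`. -/
def IsNormalElement (Fq : Type*) {L : Type*} [Field Fq] [Field L] [Algebra Fq L] (σ : L →+* L)
    (m : ℕ) (β : L) : Prop :=
  LinearIndependent Fq (fun j : Fin m => σ^[j] β) ∧
    Submodule.span Fq (Set.range fun j : Fin m => σ^[j] β) = ⊤

/-- The sum-rank BCH code `C_δ(a^b, β)`: the restriction to `F^n` of the dual of the linearized
Reed-Solomon code of dimension `δ - 1` with `𝒜 = {1, a, …, a^{ℓ-1}}` and
`ℬ_i = {β a^{b i}, σ(β) a^{b i}, …, σ^{m-1}(β) a^{b i}}`. -/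
def srBCHCode (F : Type*) {L : Type*} [Field F] [Field L] [Algebra F L] (σ : L →+* L)
    (ℓ m δ b : ℕ) (a β : L) : Submodule F (Fin ℓ × Fin m → F) :=
  subfieldSubcode F (dualCode (linRSCode σ (δ - 1) (fun i : Fin ℓ => a ^ (i : ℕ))
    fun (i : Fin ℓ) (j : Fin m) => σ^[j] β * a ^ (b * i)))

/-! ### The cyclotomic data -/

/-- `𝒥 = {j ∈ ℕ | 0 ≤ j ≤ δ - 2, μ(a^{b+j}) = 0}`. -/
def rootIndices {F L : Type*} [Field F] [Field L] [Algebra F L] (μ : F[X]) (δ b : ℕ) (a : L) :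
    Set ℕ :=
  {j | j + 2 ≤ δ ∧ aeval (a ^ (b + j)) μ = 0}

/-- The `F_q`-span of the `β^{q₀^v}` with `v = s j + m (u d + h_j) mod s m`, for `j ∈ J` and
`u = 0, …, s/d - 1`. -/
def frobSpan (Fq : Type*) {L : Type*} [Field Fq] [Field L] [Algebra Fq L] (q₀ s m d : ℕ)
    (J : Set ℕ) (h : ℕ → ℕ) (β : L) : Submodule Fq L :=
  Submodule.span Fq {y | ∃ j ∈ J, ∃ u < s / d,
    y = β ^ (q₀ ^ ((s * j + m * (u * d + h j)) % (s * m)))}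

end SumRankBCH

end

open SumRankBCH

/-!
For an `ℓ`th root of unity `α ∈ L`, which `σ` fixes, a word `c` gives the skew polynomial `c(α, z)
∈ L[z; σ]`, and this acts on `L` as the `Fq`-linear operator `c(α, σ)`. The parity checks of the
sum-rank BCH code say that `c(a ^ (b + k), σ)` kills `σ ^ k (β)` for `k ≤ δ - 2`
(`mem_srBCHCode_iff`). The coefficients of `c` are fixed by `τ : x ↦ x ^ |F|`, so that applying
the powers of `τ` gives the condition that `c(α, σ)` kills a certain `Fq`-subspace `W α` of `L`,
for each `α` (`conjSpan`, `isVanishingCode_srBCHCode`). The family `W` is compatible with `τ`.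

All the rest holds for any `τ`-equivariant family `W` of subspaces. Since `Fq` is the fixed field
of `σ`, each `W α` is the kernel of a unique monic skew polynomial `g_α` of degree `dim W α`,
which divides on the right every skew polynomial that kills `W α` (`SkewPoly.exists_annihilator`).
By uniqueness `τ` maps `g_α` to `g_{τ α}`, and interpolation at the `ℓ`th roots of unity turns
such an equivariant family into a single skew polynomial `g` over `F[x]/(x ^ ℓ - 1)`
(`IsCSCExtension.exists_skewPoly`). This is the minimal generator, and the kernels of its
evaluations give the partial defining sets (`IsCSCExtension.existsUnique_isMinimalGenerator`,
`IsCSCExtension.partialDefiningSet_eq`).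

For the dimension, the code is extended to `L`, where the maps `c ↦ (c(α, σ))_α` identify `L ^ (ℓ
m)` with the product of the `ℓ` copies of `End_Fq(L)`, so that vanishing on `W` amounts to `∑_α
dim W α` independent conditions; Galois descent brings this back to `F`
(`finrank_subfieldSubcode`, `IsCSCExtension.finrank_add_sum`).

Finally, the zeros of an irreducible factor of `x ^ ℓ - 1` of degree `d` form one orbit of `τ`, of
size `d`, along which `dim W α` is constant, and sorting the conjugates of the zeros by their
exponents identifies `W α` with the span in the statement (`frobSpan_eq_conjSpan`).
-/

open Polynomial

namespace SumRankBCH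

/-! ### Skew polynomials: coefficients, change of coefficients, operators -/

namespace SkewPoly

section Coeff

variable {R : Type*} [CommRing R] {σ : R →+* R}

theorem ext' {f g : SkewPoly σ} (h : ∀ k, f.coeff k = g.coeff k) : f = g :=
  SkewPolynomial.ext h

@[simp] theorem coeff_zero (k : ℕ) : (0 : SkewPoly σ).coeff k = 0 := rfl

@[simp] theorem coeff_add (f g : SkewPoly σ) (k : ℕ) :
    (f + g).coeff k = f.coeff k + g.coeff k := SkewPolynomial.coeff_add f g k

@[simp] theorem coeff_sub (f g : SkewPoly σ) (k : ℕ) :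
    (f - g).coeff k = f.coeff k - g.coeff k := SkewPolynomial.coeff_sub f g k

theorem coeff_monomial (n k : ℕ) (r : R) :
    (monomial σ n r).coeff k = if n = k then r else 0 :=
  SkewPolynomial.coeff_monomial

theorem coeff_X_pow (n k : ℕ) :
    (SkewPolynomial.X ^ n : SkewPoly σ).coeff k = if n = k then 1 else 0 := by
  rw [← SkewPolynomial.monomial_one_right_eq_X_pow]
  exact coeff_monomial n k 1

theorem coeff_one (k : ℕ) : (1 : SkewPoly σ).coeff k = if 0 = k then 1 else 0 :=
  coeff_monomial (σ := σ) 0 k 1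

/-- The `k`th coefficient as an additive map. -/
def coeffHom (σ : R →+* R) (k : ℕ) : SkewPoly σ →+ R where
  toFun f := f.coeff k
  map_zero' := rfl
  map_add' f g := coeff_add f g k

theorem coeff_sum {ι : Type*} (s : Finset ι) (f : ι → SkewPoly σ) (k : ℕ) :
    (∑ i ∈ s, f i).coeff k = ∑ i ∈ s, (f i).coeff k := map_sum (coeffHom σ k) f s

theorem coeff_eq_zero_of_notMem {f : SkewPoly σ} {k : ℕ}
    (h : k ∉ SkewPolynomial.support f) : f.coeff k = 0 :=
  SkewPolynomial.notMem_support_iff.1 h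

theorem monomial_add (n : ℕ) (r s : R) :
    monomial σ n (r + s) = monomial σ n r + monomial σ n s := by
  refine ext' fun k => ?_; simp only [coeff_add, coeff_monomial]; split_ifs <;> simp

theorem monomial_zero (n : ℕ) : monomial σ n 0 = 0 := by
  refine ext' fun k => ?_; simp [coeff_monomial]

theorem eq_sum_monomial (f : SkewPoly σ) :
    f = ∑ k ∈ SkewPolynomial.support f, monomial σ k (f.coeff k) := by
  refine ext' fun k => ?_
  rw [coeff_sum]
  simp only [coeff_monomial, Finset.sum_ite_eq']
  split_ifs with h
  · rfl
  · exact coeff_eq_zero_of_notMem h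

theorem exists_coeff_eq_zero (f : SkewPoly σ) : ∃ N, ∀ k, N ≤ k → f.coeff k = 0 := by
  refine ⟨(SkewPolynomial.support f).sup id + 1, fun k hk => coeff_eq_zero_of_notMem fun h => ?_⟩
  have : k ≤ _ := Finset.le_sup (f := id) h
  omega

theorem induction_on {P : SkewPoly σ → Prop} (f : SkewPoly σ)
    (hmon : ∀ n r, P (monomial σ n r)) (hadd : ∀ f g, P f → P g → P (f + g)) : P f := by
  rw [eq_sum_monomial f]
  refine Finset.sum_induction _ P hadd ?_ fun k _ => hmon _ _
  rw [← monomial_zero (σ := σ) 0]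
  exact hmon _ _

theorem monomial_mul_monomial (i j : ℕ) (r s : R) :
    monomial σ i r * monomial σ j s = monomial σ (i + j) (r * σ^[i] s) := by
  refine (SkewPolynomial.monomial_mul_monomial i j _ _).trans ?_
  rw [SkewPolynomial.φ_iterate_apply]
  rfl

theorem monomial_zero_one : monomial σ 0 1 = 1 := rfl

theorem monomial_one_right (n : ℕ) : monomial σ n 1 = SkewPolynomial.X ^ n :=
  SkewPolynomial.monomial_one_right_eq_X_pow n

/-- An additive map out of a skew polynomial ring is multiplicative if it is so on monomials. -/
theorem map_mul_of_monomial {A : Type*} [NonUnitalNonAssocSemiring A] (Φ : SkewPoly σ →+ A)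
    (h : ∀ i j r s, Φ (monomial σ i r * monomial σ j s) =
      Φ (monomial σ i r) * Φ (monomial σ j s)) (f g : SkewPoly σ) : Φ (f * g) = Φ f * Φ g := by
  induction f using induction_on with
  | hadd f f' hf hf' => rw [add_mul, map_add, hf, hf', map_add, add_mul]
  | hmon n r =>
    induction g using induction_on with
    | hadd f f' hf hf' => rw [mul_add, map_add, hf, hf', map_add, mul_add]
    | hmon n r => exact h _ _ _ _

theorem coeff_mul (f g : SkewPoly σ) (n : ℕ) :
    (f * g).coeff n =
      ∑ p ∈ Finset.HasAntidiagonal.antidiagonal n, f.coeff p.1 * σ^[p.1] (g.coeff p.2) := by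
  induction f using induction_on with
  | hadd f f' hf hf' => simp [add_mul, hf, hf', Finset.sum_add_distrib]
  | hmon i r =>
    induction g using induction_on with
    | hadd g g' hg hg' => simp [mul_add, hg, hg', Finset.sum_add_distrib, iterate_map_add]
    | hmon j s =>
      rw [monomial_mul_monomial, coeff_monomial]
      have key : ∀ p ∈ Finset.HasAntidiagonal.antidiagonal n,
          (monomial σ i r).coeff p.1 * σ^[p.1] ((monomial σ j s).coeff p.2) =
            if (i, j) = p then r * σ^[i] s else 0 := by
        rintro ⟨k, l⟩ -
        simp only [coeff_monomial, Prod.mk.injEq]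
        split_ifs <;> simp_all [iterate_map_zero]
      rw [Finset.sum_congr rfl key, Finset.sum_ite_eq]
      simp

/-- `f` is monic of degree `d` in `z`. -/
def IsMonicOfDegree (f : SkewPoly σ) (d : ℕ) : Prop :=
  f.coeff d = 1 ∧ ∀ k, d < k → f.coeff k = 0

theorem coeff_mul_of_lt {f g : SkewPoly σ} {d e : ℕ} (hf : ∀ k, d < k → f.coeff k = 0)
    (hg : ∀ k, e < k → g.coeff k = 0) {k : ℕ} (hk : d + e < k) : (f * g).coeff k = 0 := by
  rw [coeff_mul]
  refine Finset.sum_eq_zero fun p hp => ?_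
  rw [Finset.HasAntidiagonal.mem_antidiagonal] at hp
  by_cases h : d < p.1
  · rw [hf _ h, zero_mul]
  · rw [hg _ (by omega), iterate_map_zero, mul_zero]

theorem coeff_mul_add {f g : SkewPoly σ} {d e : ℕ} (hf : ∀ k, d < k → f.coeff k = 0)
    (hg : ∀ k, e < k → g.coeff k = 0) :
    (f * g).coeff (d + e) = f.coeff d * σ^[d] (g.coeff e) := by
  rw [coeff_mul, Finset.sum_eq_single (d, e)]
  · rintro ⟨i, j⟩ hp hne
    rw [Finset.HasAntidiagonal.mem_antidiagonal] at hp
    by_cases h : d < i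
    · rw [hf _ h, zero_mul]
    · have : e < j := by
        by_contra hj
        exact hne (Prod.ext (by simp at hp ⊢; omega) (by simp at hp ⊢; omega))
      rw [hg _ this, iterate_map_zero, mul_zero]
  · simp

namespace IsMonicOfDegree

variable {f g : SkewPoly σ} {d e : ℕ}

theorem one : IsMonicOfDegree (1 : SkewPoly σ) 0 :=
  ⟨by simp [coeff_one], fun k hk => by rw [coeff_one, if_neg (by omega)]⟩

theorem mul (hf : IsMonicOfDegree f d) (hg : IsMonicOfDegree g e) :
    IsMonicOfDegree (f * g) (d + e) :=
  ⟨by rw [coeff_mul_add hf.2 hg.2, hf.1, hg.1, iterate_map_one, mul_one],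
    fun _ hk => coeff_mul_of_lt hf.2 hg.2 hk⟩

theorem X_pow_sub_one {N : ℕ} (hN : 0 < N) :
    IsMonicOfDegree (SkewPolynomial.X ^ N - 1 : SkewPoly σ) N := by
  constructor
  · simp [coeff_X_pow, coeff_one, hN.ne]
  · intro k hk
    rw [coeff_sub, coeff_X_pow, coeff_one, if_neg (by omega), if_neg (by omega), sub_zero]

theorem X_sub_C (c : R) :
    IsMonicOfDegree (SkewPolynomial.X - SkewPolynomial.C (Twist.of σ c) : SkewPoly σ) 1 := by
  have h : (SkewPolynomial.X - SkewPolynomial.C (Twist.of σ c) : SkewPoly σ) =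
      monomial σ 1 1 - monomial σ 0 c := rfl
  rw [h]
  constructor
  · simp [coeff_monomial]
  · intro k hk
    rw [coeff_sub, coeff_monomial, coeff_monomial, if_neg (by omega), if_neg (by omega), sub_zero]

theorem degree_unique [Nontrivial R] (hd : IsMonicOfDegree f d) (he : IsMonicOfDegree f e) :
    d = e := by
  rcases lt_trichotomy d e with h | h | h
  · exact absurd ((hd.2 e h).symm.trans he.1) zero_ne_one
  · exact h
  · exact absurd ((he.2 d h).symm.trans hd.1) zero_ne_one

end IsMonicOfDegree

/-- A nonzero skew polynomial has a leading coefficient. -/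
theorem exists_leading {f : SkewPoly σ} (hf : f ≠ 0) :
    ∃ d, f.coeff d ≠ 0 ∧ ∀ k, d < k → f.coeff k = 0 := by
  have hne : (SkewPolynomial.support f).Nonempty := by
    rw [Finset.nonempty_iff_ne_empty]
    simpa using hf
  refine ⟨_, SkewPolynomial.mem_support_iff.1 (Finset.max'_mem _ hne), fun k hk => ?_⟩
  by_contra h
  exact (Finset.le_max' _ k (SkewPolynomial.mem_support_iff.2 h)).not_gt hk

theorem eq_zero_of_mul_eq_zero {f g : SkewPoly σ} {e : ℕ} (hg : IsMonicOfDegree g e)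
    (h : f * g = 0) : f = 0 := by
  by_contra hf
  obtain ⟨d, hd, hd'⟩ := exists_leading hf
  apply hd
  have := coeff_mul_add hd' hg.2
  rwa [h, hg.1, iterate_map_one, mul_one, coeff_zero, eq_comm] at this

theorem mul_right_cancel_of_monic {f f' g : SkewPoly σ} {e : ℕ} (hg : IsMonicOfDegree g e)
    (h : f * g = f' * g) : f = f' :=
  sub_eq_zero.1 (eq_zero_of_mul_eq_zero hg (by rw [sub_mul, h, sub_self]))

/-- The left factor of a monic skew polynomial by a monic right factor is monic. -/
theorem IsMonicOfDegree.of_mul [Nontrivial R] {f g : SkewPoly σ} {n e : ℕ}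
    (h : IsMonicOfDegree (f * g) n) (hg : IsMonicOfDegree g e) :
    ∃ d, IsMonicOfDegree f d ∧ d + e = n := by
  have hf : f ≠ 0 := by
    rintro rfl
    exact zero_ne_one (α := R) (by simpa using h.1)
  obtain ⟨d, hd, hd'⟩ := exists_leading hf
  have h1 := coeff_mul_add hd' hg.2
  rw [hg.1, iterate_map_one, mul_one] at h1
  have h2 : d + e = n := by
    rcases lt_trichotomy (d + e) n with hlt | heq | hgt
    · exact absurd ((coeff_mul_of_lt hd' hg.2 hlt).symm.trans h.1) zero_ne_one
    · exact heq
    · exact absurd (h1.symm.trans (h.2 _ hgt)) hd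
  exact ⟨d, ⟨by rw [← h1, h2, h.1], hd'⟩, h2⟩

/-- Two monic skew polynomials that generate the same left ideal are equal. -/
theorem eq_of_left_associated [Nontrivial R] {f g u v : SkewPoly σ} {d e : ℕ}
    (hf : IsMonicOfDegree f d) (hg : IsMonicOfDegree g e) (hfg : f = u * g) (hgf : g = v * f) :
    f = g := by
  obtain ⟨i, hu, hi⟩ := (hfg ▸ hf).of_mul hg
  obtain ⟨j, -, hj⟩ := (hgf ▸ hg).of_mul hf
  obtain rfl : i = 0 := by omega
  have : u = 1 := by
    refine ext' fun k => ?_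
    rcases Nat.eq_zero_or_pos k with rfl | hk
    · rw [hu.1, (IsMonicOfDegree.one (σ := σ)).1]
    · rw [hu.2 k hk, (IsMonicOfDegree.one (σ := σ)).2 k hk]
  rw [hfg, this, one_mul]

/-- If `σ ^ N = 1` then `z ^ N` is central in `R[z; σ]`. -/
theorem X_pow_mul_comm {N : ℕ} (hσ : ∀ x, σ^[N] x = x) (f : SkewPoly σ) :
    f * SkewPolynomial.X ^ N = SkewPolynomial.X ^ N * f := by
  rw [← monomial_one_right]
  induction f using induction_on with
  | hadd f g hf hg => rw [add_mul, mul_add, hf, hg]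
  | hmon n r => rw [monomial_mul_monomial, monomial_mul_monomial, iterate_map_one, hσ, mul_one,
      one_mul, add_comm]

theorem X_pow_sub_one_mul_comm {N : ℕ} (hσ : ∀ x, σ^[N] x = x) (f : SkewPoly σ) :
    f * (SkewPolynomial.X ^ N - 1) = (SkewPolynomial.X ^ N - 1) * f := by
  rw [mul_sub, sub_mul, X_pow_mul_comm hσ, mul_one, one_mul]

end Coeff

section Map

variable {R R' : Type*} [CommRing R] [CommRing R'] {σ : R →+* R} {σ' : R' →+* R'}

@[simp] theorem coeff_map (π : R →+* R') (f : SkewPoly σ) (k : ℕ) :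
    (map σ' π f).coeff k = π (f.coeff k) := by
  rw [map, coeff_sum]
  simp only [coeff_monomial, Finset.sum_ite_eq']
  split_ifs with h
  · rfl
  · rw [coeff_eq_zero_of_notMem h, map_zero]

theorem map_monomial (π : R →+* R') (n : ℕ) (r : R) :
    map σ' π (monomial σ n r) = monomial σ' n (π r) := by
  refine ext' fun k => ?_; rw [coeff_map, coeff_monomial, coeff_monomial]; split_ifs <;> simp

theorem map_add (π : R →+* R') (f g : SkewPoly σ) :
    map σ' π (f + g) = map σ' π f + map σ' π g := by
  refine ext' fun k => ?_; simp

theorem map_sub (π : R →+* R') (f g : SkewPoly σ) :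
    map σ' π (f - g) = map σ' π f - map σ' π g := by
  refine ext' fun k => ?_; simp

theorem map_X_pow (π : R →+* R') (n : ℕ) :
    map σ' π (SkewPolynomial.X ^ n : SkewPoly σ) = SkewPolynomial.X ^ n := by
  rw [← monomial_one_right, map_monomial, _root_.map_one, monomial_one_right]

theorem map_one (π : R →+* R') : map σ' π (1 : SkewPoly σ) = 1 := by
  rw [← monomial_zero_one, map_monomial, _root_.map_one, monomial_zero_one]

theorem map_mul {π : R →+* R'} (hπ : ∀ r, π (σ r) = σ' (π r)) (f g : SkewPoly σ) :
    map σ' π (f * g) = map σ' π f * map σ' π g := by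
  let Φ : SkewPoly σ →+ SkewPoly σ' :=
    { toFun := map σ' π
      map_zero' := by refine ext' fun k => ?_; simp
      map_add' := map_add π }
  refine map_mul_of_monomial Φ (fun i j r s => ?_) f g
  change map σ' π _ = map σ' π _ * map σ' π _
  rw [monomial_mul_monomial, map_monomial, map_monomial, map_monomial, monomial_mul_monomial,
    _root_.map_mul, (Function.Semiconj.iterate_right (f := π) hπ i).eq]

theorem isMonicAlong_iff (π : R →+* R') (σ' : R' →+* R') (f : SkewPoly σ) :
    f.IsMonicAlong π ↔ ∃ d, IsMonicOfDegree (map σ' π f) d := by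
  simp [IsMonicAlong, IsMonicOfDegree]

end Map

section Op

variable {L : Type*} [CommRing L] (σ : L →+* L)

/-- The operator `x ↦ ∑ k, f_k σ ^ k (x)` attached to a skew polynomial `f = ∑ k, f_k z ^ k`. -/
def op : SkewPoly σ →+ AddMonoid.End L where
  toFun f :=
    { toFun := fun x => ∑ k ∈ SkewPolynomial.support f, f.coeff k * σ^[k] x
      map_zero' := by simp [iterate_map_zero]
      map_add' := fun x y => by simp [iterate_map_add, mul_add, Finset.sum_add_distrib] }
  map_zero' := rfl
  map_add' f g := by
    have h : ∀ (f : SkewPoly σ) (s : Finset ℕ), SkewPolynomial.support f ⊆ s → ∀ x,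
        ∑ k ∈ SkewPolynomial.support f, f.coeff k * σ^[k] x = ∑ k ∈ s, f.coeff k * σ^[k] x :=
      fun f s hs x => Finset.sum_subset hs fun k _ hk => by
        rw [coeff_eq_zero_of_notMem hk, zero_mul]
    ext x
    change ∑ k ∈ SkewPolynomial.support (f + g), (f + g).coeff k * σ^[k] x =
      ∑ k ∈ SkewPolynomial.support f, f.coeff k * σ^[k] x +
        ∑ k ∈ SkewPolynomial.support g, g.coeff k * σ^[k] x
    rw [h (f + g) _ SkewPolynomial.support_add, h f _ Finset.subset_union_left,
      h g _ Finset.subset_union_right, ← Finset.sum_add_distrib]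
    exact Finset.sum_congr rfl fun k _ => by rw [coeff_add, add_mul]

theorem op_monomial (n : ℕ) (r x : L) : op σ (monomial σ n r) x = r * σ^[n] x := by
  change ∑ k ∈ _, _ = _
  rw [Finset.sum_subset (s₂ := {n})]
  · simp [coeff_monomial]
  · exact SkewPolynomial.support_monomial_subset _
  · intro k _ hk
    rw [coeff_eq_zero_of_notMem hk, zero_mul]

theorem op_add (f g : SkewPoly σ) (x : L) : op σ (f + g) x = op σ f x + op σ g x := by
  rw [_root_.map_add]; rfl

theorem op_sub (f g : SkewPoly σ) (x : L) : op σ (f - g) x = op σ f x - op σ g x := by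
  rw [_root_.map_sub]; rfl

theorem op_mul (f g : SkewPoly σ) (x : L) : op σ (f * g) x = op σ f (op σ g x) := by
  have := map_mul_of_monomial (op σ) (fun i j r s => by
    ext x
    change _ = op σ (monomial σ i r) (op σ (monomial σ j s) x)
    rw [monomial_mul_monomial, op_monomial, op_monomial, op_monomial,
      iterate_map_mul, Function.iterate_add_apply, mul_assoc]) f g
  rw [this]
  rfl

theorem op_X_pow (n : ℕ) (x : L) : op σ (SkewPolynomial.X ^ n) x = σ^[n] x := by
  rw [← monomial_one_right, op_monomial, one_mul]

theorem op_one (x : L) : op σ 1 x = x := by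
  rw [← monomial_zero_one, op_monomial, one_mul]; rfl

theorem op_X_sub_C (c x : L) :
    op σ (SkewPolynomial.X - SkewPolynomial.C (Twist.of σ c)) x = σ x - c * x := by
  have h : (SkewPolynomial.X - SkewPolynomial.C (Twist.of σ c) : SkewPoly σ) =
      monomial σ 1 1 - monomial σ 0 c := rfl
  rw [h, op_sub, op_monomial, op_monomial]
  simp

theorem op_sum_monomial {ι : Type*} (s : Finset ι) (n : ι → ℕ) (r : ι → L) (x : L) :
    op σ (∑ i ∈ s, monomial σ (n i) (r i)) x = ∑ i ∈ s, r i * σ^[n i] x := by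
  classical
  induction s using Finset.induction_on with
  | empty => rw [Finset.sum_empty, Finset.sum_empty, map_zero]; rfl
  | insert i s hi ih => rw [Finset.sum_insert hi, Finset.sum_insert hi, op_add, op_monomial, ih]

/-- If `τ` commutes with `σ`, conjugating the operator of `f` by `τ` gives the operator of
`τ(f)`. -/
theorem op_map {τ : L →+* L} (hτ : ∀ x, τ (σ x) = σ (τ x)) (f : SkewPoly σ) (x : L) :
    op σ (map σ τ f) (τ x) = τ (op σ f x) := by
  induction f using induction_on with
  | hadd f g hf hg =>
    rw [map_add, op_add, op_add, hf, hg, _root_.map_add]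
  | hmon n r =>
    rw [map_monomial, op_monomial, op_monomial, _root_.map_mul,
      (Function.Semiconj.iterate_right (f := τ) hτ n).eq]

end Op

end SkewPoly

/-! ### Right roots and annihilators of subspaces -/

namespace SkewPoly

section Annihilator

variable {L : Type*} [Field L] {σ : L →+* L}

/-- Right division by `z - c`, with constant remainder. -/
theorem exists_eq_mul_X_sub_C_add (c : L) (f : SkewPoly σ) :
    ∃ (Q : SkewPoly σ) (r : L),
      f = Q * (SkewPolynomial.X - SkewPolynomial.C (Twist.of σ c)) + monomial σ 0 r := by
  have h : (SkewPolynomial.X - SkewPolynomial.C (Twist.of σ c) : SkewPoly σ) =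
      monomial σ 1 1 - monomial σ 0 c := rfl
  rw [h]
  induction f using induction_on with
  | hadd f g hf hg =>
    obtain ⟨Q, r, rfl⟩ := hf
    obtain ⟨Q', r', rfl⟩ := hg
    exact ⟨Q + Q', r + r', by rw [monomial_add, add_mul]; abel⟩
  | hmon n r =>
    induction n generalizing r with
    | zero => exact ⟨0, r, by simp⟩
    | succ n ih =>
      obtain ⟨Q, r', hQ⟩ := ih (r * σ^[n] c)
      refine ⟨monomial σ n r + Q, r', ?_⟩
      rw [add_mul, add_assoc, ← hQ, mul_sub, monomial_mul_monomial, monomial_mul_monomial]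
      simp

/-- The operator of `f` kills `γ ≠ 0` exactly when `z - σ(γ) γ⁻¹` divides `f` on the right. -/
theorem op_eq_zero_iff {γ : L} (hγ : γ ≠ 0) (f : SkewPoly σ) :
    op σ f γ = 0 ↔ ∃ Q : SkewPoly σ, f = Q *
      (SkewPolynomial.X - SkewPolynomial.C (Twist.of σ (σ γ * γ⁻¹))) := by
  have h0 : op σ (SkewPolynomial.X - SkewPolynomial.C (Twist.of σ (σ γ * γ⁻¹))) γ = 0 := by
    rw [op_X_sub_C, mul_assoc, inv_mul_cancel₀ hγ, mul_one, sub_self]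
  constructor
  · intro h
    obtain ⟨Q, r, hQ⟩ := exists_eq_mul_X_sub_C_add (σ γ * γ⁻¹) f
    refine ⟨Q, ?_⟩
    rw [hQ, op_add, op_mul, h0, _root_.map_zero, zero_add, op_monomial] at h
    have : r = 0 := by simpa [hγ] using h
    rw [hQ, this, monomial_zero, add_zero]
  · rintro ⟨Q, rfl⟩
    rw [op_mul, h0, _root_.map_zero]

variable {K : Type*} [Field K] [Algebra K L]

theorem op_smul (hfix : ∀ y : K, σ (algebraMap K L y) = algebraMap K L y) (f : SkewPoly σ)
    (y : K) (x : L) : op σ f (y • x) = y • op σ f x := by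
  have hit : ∀ n, σ^[n] (algebraMap K L y) = algebraMap K L y := fun n =>
    Function.iterate_fixed (hfix y) n
  induction f using induction_on with
  | hadd f g hf hg => rw [op_add, op_add, hf, hg, smul_add]
  | hmon n r =>
    rw [op_monomial, op_monomial, Algebra.smul_def, iterate_map_mul, hit, Algebra.smul_def]
    ring

/-- The annihilator of the span of independent vectors, built one vector at a time: if `g` has
kernel `W` and `w ∉ W`, then `c = g(w) ≠ 0` and `(z - σ(c) / c) g` has kernel `W + K w`. -/
theorem exists_annihilator_of_linearIndependent
    (hfix : ∀ x : L, σ x = x ↔ ∃ y : K, algebraMap K L y = x) (n : ℕ) (v : Fin n → L)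
    (hv : LinearIndependent K v) :
    ∃ g : SkewPoly σ, IsMonicOfDegree g n ∧
      (∀ x, op σ g x = 0 ↔ x ∈ Submodule.span K (Set.range v)) ∧
      ∀ f : SkewPoly σ, (∀ x ∈ Submodule.span K (Set.range v), op σ f x = 0) → ∃ Q, f = Q * g := by
  have hfix' : ∀ y : K, σ (algebraMap K L y) = algebraMap K L y := fun y => (hfix _).2 ⟨y, rfl⟩
  induction n with
  | zero =>
    refine ⟨1, IsMonicOfDegree.one, fun x => ?_, fun f _ => ⟨f, (mul_one f).symm⟩⟩
    rw [op_one, Set.range_eq_empty, Submodule.span_empty, Submodule.mem_bot]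
  | succ n ih =>
    rw [linearIndependent_finSucc] at hv
    obtain ⟨g, hg, hker, hdvd⟩ := ih (Fin.tail v) hv.1
    have hc : op σ g (v 0) ≠ 0 := fun h => hv.2 ((hker _).1 h)
    set c := op σ g (v 0) with hcdef
    have hspan : ∀ x, x ∈ Submodule.span K (Set.range v) ↔
        ∃ y : K, op σ g x = y • c := by
      intro x
      rw [← Fin.cons_self_tail v, Fin.range_cons, Submodule.mem_span_insert']
      constructor
      · rintro ⟨y, hy⟩
        refine ⟨-y, ?_⟩
        rw [← hker, _root_.map_add, op_smul hfix'] at hy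
        rw [neg_smul]
        exact eq_neg_of_add_eq_zero_left hy
      · rintro ⟨y, hy⟩
        refine ⟨-y, ?_⟩
        rw [← hker, _root_.map_add, op_smul hfix', hy, ← hcdef, neg_smul, add_neg_cancel]
    refine ⟨(SkewPolynomial.X - SkewPolynomial.C (Twist.of σ (σ c * c⁻¹))) * g,
      by rw [add_comm]; exact (IsMonicOfDegree.X_sub_C _).mul hg, fun x => ?_, fun f hf => ?_⟩
    · rw [hspan, op_mul, op_X_sub_C]
      constructor
      · intro h
        obtain ⟨y, hy⟩ := (hfix (op σ g x * c⁻¹)).1 (by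
          rw [_root_.map_mul, map_inv₀, sub_eq_zero.1 h]
          have : σ c ≠ 0 := (_root_.map_ne_zero σ).2 hc
          field_simp)
        exact ⟨y, by rw [Algebra.smul_def, hy, mul_assoc, inv_mul_cancel₀ hc, mul_one]⟩
      · rintro ⟨y, hy⟩
        rw [hy, Algebra.smul_def, _root_.map_mul, hfix']
        field_simp
        ring
    -- If `f` kills the larger span, then `f = Q g`, and `Q` kills `c`.
    · obtain ⟨Q, rfl⟩ := hdvd f fun x hx => hf x ((hspan x).2 ⟨0, by rw [(hker x).2 hx, zero_smul]⟩)
      have h0 := hf (v 0) (Submodule.subset_span ⟨0, rfl⟩)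
      rw [op_mul, ← hcdef, op_eq_zero_iff hc] at h0
      obtain ⟨Q', rfl⟩ := h0
      exact ⟨Q', mul_assoc _ _ _⟩

/-- A finite-dimensional `K`-subspace `W` of `L`, where `K` is the fixed field of `σ`, is the kernel
of a monic skew polynomial of degree `dim W` which divides on the right all those that vanish
on `W`. -/
theorem exists_annihilator [FiniteDimensional K L]
    (hfix : ∀ x : L, σ x = x ↔ ∃ y : K, algebraMap K L y = x) (W : Submodule K L) :
    ∃ g : SkewPoly σ, IsMonicOfDegree g (Module.finrank K W) ∧
      (∀ x, op σ g x = 0 ↔ x ∈ W) ∧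
      ∀ f : SkewPoly σ, (∀ x ∈ W, op σ f x = 0) → ∃ Q, f = Q * g := by
  let B := Module.finBasis K W
  have hspan : Submodule.span K (Set.range fun i => (B i : L)) = W := by
    rw [show (Set.range fun i => (B i : L)) = W.subtype '' Set.range B by
      rw [← Set.range_comp]; rfl, Submodule.span_image, B.span_eq, Submodule.map_top,
      Submodule.range_subtype]
  have := exists_annihilator_of_linearIndependent hfix _ (fun i => (B i : L))
    (B.linearIndependent.map' W.subtype (Submodule.ker_subtype W))
  rwa [hspan] at this

end Annihilator

end SkewPoly

/-! ### Descent from the evaluations at the roots of unity -/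

/-- The fields behind cyclic-skew-cyclic codes: `L` contains the alphabet `F`, on which `σL`
restricts to `σ`, and the fixed field `Fq` of `σL`, over which it has degree `m`; `τ` generates the
Galois group of `L / F`; and `L` contains the `ℓ`th roots of unity, which are fixed by `σL`. -/
structure IsCSCExtension (Fq : Type*) {F L : Type*} [Field F] [Field Fq] [Field L] [Algebra F L]
    [Algebra Fq L] (σ : F →+* F) (σL : L →+* L) (τ : L ≃ₐ[F] L) (ℓ m : ℕ) : Prop where
  ell_pos : 0 < ℓ
  pos : 0 < m
  map_sigma : ∀ x, algebraMap F L (σ x) = σL (algebraMap F L x)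
  comm : ∀ x, τ (σL x) = σL (τ x)
  generates : ∀ g : L ≃ₐ[F] L, ∃ k : ℕ, g = τ ^ k
  fixed_tau : ∀ x, τ x = x → ∃ y, algebraMap F L y = x
  fixed_sigma : ∀ x, σL x = x ↔ ∃ y : Fq, algebraMap Fq L y = x
  sigma_iterate : ∀ x, σL^[m] x = x
  sigma_order : ∀ k < m, (∀ x, σL^[k] x = x) → k = 0
  finrank_eq : Module.finrank Fq L = m
  root_fixed : ∀ α : L, α ^ ℓ = 1 → σL α = α
  exists_root : ∃ a : L, IsPrimitiveRoot a ℓ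

section Descent

variable {Fq F L : Type*} [Field F] [Field Fq] [Field L] [Algebra F L] [Algebra Fq L]
  {σ : F →+* F} {σL : L →+* L} {τ : L ≃ₐ[F] L} {ℓ m : ℕ}

theorem pow_eq_one_of_algEquiv (τ : L ≃ₐ[F] L) {α : L} (hα : α ^ ℓ = 1) : (τ α) ^ ℓ = 1 := by
  rw [← _root_.map_pow, hα, _root_.map_one]

theorem cycEval_mk {α : L} (hα : α ^ ℓ = 1) (p : F[X]) :
    cycEval α hα (AdjoinRoot.mk _ p) = aeval α p := by
  rw [cycEval, AdjoinRoot.lift_mk]; rfl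

theorem algEquiv_cycEval (τ : L ≃ₐ[F] L) {α : L} (hα : α ^ ℓ = 1) (r : CycRing F ℓ) :
    τ (cycEval α hα r) = cycEval (τ α) (pow_eq_one_of_algEquiv τ hα) r := by
  induction r using AdjoinRoot.induction_on with
  | ih p => rw [cycEval_mk, cycEval_mk, ← aeval_algHom_apply]

/-- The value `f(α, z)` of `f ∈ 𝒮[z; σ]` at an `ℓ`th root of unity `α`. -/
noncomputable abbrev evalRoot (σL : L →+* L) {α : L} (hα : α ^ ℓ = 1)
    (f : SkewPoly (cycSigma σ ℓ)) : SkewPoly σL := SkewPoly.map σL (cycEval α hα) f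

theorem map_evalRoot (τ : L ≃ₐ[F] L) {α : L} (hα : α ^ ℓ = 1) (f : SkewPoly (cycSigma σ ℓ)) :
    SkewPoly.map σL (τ : L →+* L) (evalRoot σL hα f) =
      evalRoot σL (pow_eq_one_of_algEquiv τ hα) f := by
  refine SkewPoly.ext' fun k => ?_
  rw [SkewPoly.coeff_map, SkewPoly.coeff_map, SkewPoly.coeff_map]
  exact algEquiv_cycEval τ hα _

namespace IsCSCExtension

theorem card_roots (H : IsCSCExtension Fq σ σL τ ℓ m) :
    (nthRootsFinset ℓ (1 : L)).card = ℓ := by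
  obtain ⟨a, ha⟩ := H.exists_root
  exact ha.card_nthRootsFinset

theorem mem_roots (H : IsCSCExtension Fq σ σL τ ℓ m) {α : L} :
    α ∈ nthRootsFinset ℓ (1 : L) ↔ α ^ ℓ = 1 := mem_nthRootsFinset H.ell_pos 1

theorem cycEval_cycSigma (H : IsCSCExtension Fq σ σL τ ℓ m) {α : L} (hα : α ^ ℓ = 1)
    (r : CycRing F ℓ) : cycEval α hα (cycSigma σ ℓ r) = σL (cycEval α hα r) := by
  have : (cycEval α hα).comp (cycSigma σ ℓ) = σL.comp (cycEval α hα) := by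
    refine AdjoinRoot.ringHom_ext ?_ ?_
    · ext x
      simp [cycEval, cycSigma, H.map_sigma]
    · simp [cycEval, cycSigma, H.root_fixed α hα]
  exact RingHom.congr_fun this r

theorem evalRoot_mul (H : IsCSCExtension Fq σ σL τ ℓ m) {α : L} (hα : α ^ ℓ = 1)
    (f g : SkewPoly (cycSigma σ ℓ)) :
    evalRoot σL hα (f * g) = evalRoot σL hα f * evalRoot σL hα g :=
  SkewPoly.map_mul (H.cycEval_cycSigma hα) f g

/-- An element of `𝒮` is determined by its values at the `ℓ`th roots of unity in `L`. -/
theorem cycRing_ext (H : IsCSCExtension Fq σ σL τ ℓ m) {r s : CycRing F ℓ}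
    (h : ∀ (α : L) (hα : α ^ ℓ = 1), cycEval α hα r = cycEval α hα s) : r = s := by
  rw [← sub_eq_zero]
  replace h : ∀ (α : L) (hα : α ^ ℓ = 1), cycEval α hα (r - s) = 0 := fun α hα => by
    rw [_root_.map_sub, h, sub_self]
  obtain ⟨p, hp⟩ := AdjoinRoot.mk_surjective (r - s)
  simp only [← hp, cycEval_mk] at h
  rw [← hp, AdjoinRoot.mk_eq_zero]
  have hmonic : (X ^ ℓ - 1 : F[X]).Monic := by
    simpa using monic_X_pow_sub_C (1 : F) H.ell_pos.ne'
  rw [← modByMonic_eq_zero_iff_dvd hmonic]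
  have hdeg : (p %ₘ (X ^ ℓ - 1)).degree < ℓ := by
    refine (degree_modByMonic_lt p hmonic).trans_eq ?_
    simpa using degree_X_pow_sub_C H.ell_pos (1 : F)
  have hmap : (p %ₘ (X ^ ℓ - 1)).map (algebraMap F L) = 0 := by
    refine eq_zero_of_degree_lt_of_eval_finset_eq_zero (nthRootsFinset ℓ (1 : L)) ?_ ?_
    · rw [degree_map, H.card_roots]; exact hdeg
    · intro α hα
      rw [H.mem_roots] at hα
      rw [eval_map_algebraMap, aeval_modByMonic_eq_self_of_root, h α hα]
      simp [hα]
  exact (Polynomial.map_eq_zero _).1 hmap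

theorem skewPoly_ext (H : IsCSCExtension Fq σ σL τ ℓ m) {f g : SkewPoly (cycSigma σ ℓ)}
  (h : ∀ (α : L) (hα : α ^ ℓ = 1), evalRoot σL hα f = evalRoot σL hα g) : f = g := by
  refine SkewPoly.ext' fun k => H.cycRing_ext (L := L) fun α hα => ?_
  have := congrArg (fun f => SkewPoly.coeff f k) (h α hα)
  simpa only [SkewPoly.coeff_map] using this

/-- A `τ`-equivariant function on the `ℓ`th roots of unity comes from an element of `𝒮`: its
interpolation polynomial is fixed by `τ`, hence has coefficients in `F`. -/
theorem exists_cycRing (H : IsCSCExtension Fq σ σL τ ℓ m) (v : L → L)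
    (hv : ∀ α : L, α ^ ℓ = 1 → τ (v α) = v (τ α)) :
    ∃ r : CycRing F ℓ, ∀ (α : L) (hα : α ^ ℓ = 1), cycEval α hα r = v α := by
  classical
  set A := nthRootsFinset ℓ (1 : L) with hA
  set P := Lagrange.interpolate A id v with hP
  have hinj : Set.InjOn (id : L → L) A := Function.injective_id.injOn
  have heval : ∀ α ∈ A, P.eval α = v α := fun α hα =>
    Lagrange.eval_interpolate_at_node v hinj hα
  have hdeg : P.degree < A.card := Lagrange.degree_interpolate_lt v hinj
  have htau : P.map (τ : L →+* L) = P := by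
    refine eq_of_degrees_lt_of_eval_finset_eq A ?_ hdeg fun α hα => ?_
    · rwa [degree_map]
    · obtain ⟨γ, rfl⟩ := τ.surjective α
      have hγ : γ ^ ℓ = 1 := by
        rw [H.mem_roots, ← _root_.map_pow] at hα
        exact τ.injective (by rw [hα, _root_.map_one])
      rw [heval _ hα, ← hv γ hγ, ← heval γ (H.mem_roots.2 hγ)]
      exact (eval_map_apply (τ : L →+* L) γ)
  have hlift : P ∈ lifts (algebraMap F L) := by
    rw [lifts_iff_coeff_lifts]
    intro k
    refine H.fixed_tau _ ?_
    conv_rhs => rw [← htau, coeff_map]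
    rfl
  obtain ⟨p, hp⟩ := (mem_lifts _).1 hlift
  refine ⟨AdjoinRoot.mk _ p, fun α hα => ?_⟩
  rw [cycEval_mk, ← heval α (H.mem_roots.2 hα), ← hp, eval_map_algebraMap]

/-- A `τ`-equivariant family of skew polynomials, indexed by the `ℓ`th roots of unity, comes from
an element of `𝒮[z; σ]`. -/
theorem exists_skewPoly (H : IsCSCExtension Fq σ σL τ ℓ m) (f : L → SkewPoly σL)
    (hf : ∀ α : L, α ^ ℓ = 1 → SkewPoly.map σL (τ : L →+* L) (f α) = f (τ α)) :
    ∃ g : SkewPoly (cycSigma σ ℓ), ∀ (α : L) (hα : α ^ ℓ = 1), evalRoot σL hα g = f α := by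
  choose N hN using fun α => SkewPoly.exists_coeff_eq_zero (f α)
  have hex : ∀ k, ∃ r : CycRing F ℓ, ∀ (α : L) (hα : α ^ ℓ = 1),
      cycEval α hα r = (f α).coeff k := fun k =>
    H.exists_cycRing (fun α => (f α).coeff k) fun α hα => by
      rw [← hf α hα, SkewPoly.coeff_map]; rfl
  choose r hr using hex
  let M := (nthRootsFinset ℓ (1 : L)).sup N
  refine ⟨∑ k ∈ Finset.range M, SkewPoly.monomial _ k (r k), fun α hα =>
    SkewPoly.ext' fun k => ?_⟩
  rw [SkewPoly.coeff_map, SkewPoly.coeff_sum]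
  simp only [SkewPoly.coeff_monomial, Finset.sum_ite_eq', Finset.mem_range]
  split_ifs with hk
  · exact hr k α hα
  · rw [_root_.map_zero, hN α k]
    exact (Finset.le_sup (f := N) (H.mem_roots.2 hα)).trans (not_lt.1 hk)

theorem comm_symm (H : IsCSCExtension Fq σ σL τ ℓ m) (x : L) :
    τ.symm (σL x) = σL (τ.symm x) := by
  rw [AlgEquiv.symm_apply_eq, H.comm, AlgEquiv.apply_symm_apply]

/-- A family of `Fq`-subspaces of `L`, indexed by the `ℓ`th roots of unity and stable under `τ`. -/
def IsEquivariant (τ : L ≃ₐ[F] L) (ℓ : ℕ) (W : L → Submodule Fq L) : Prop :=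
  ∀ α : L, α ^ ℓ = 1 → ∀ x, τ x ∈ W (τ α) ↔ x ∈ W α

theorem map_isMonicOfDegree {R R' : Type*} [CommRing R] [CommRing R'] {σ : R →+* R}
    (σ' : R' →+* R') (π : R →+* R') {f : SkewPoly σ} {d : ℕ} (hf : f.IsMonicOfDegree d) :
    (SkewPoly.map σ' π f).IsMonicOfDegree d :=
  ⟨by rw [SkewPoly.coeff_map, hf.1, _root_.map_one],
    fun k hk => by rw [SkewPoly.coeff_map, hf.2 k hk, _root_.map_zero]⟩

theorem map_symm_map (τ : L ≃ₐ[F] L) (f : SkewPoly σL) :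
    SkewPoly.map σL (τ : L →+* L) (SkewPoly.map σL (τ.symm : L →+* L) f) = f := by
  refine SkewPoly.ext' fun k => ?_
  rw [SkewPoly.coeff_map, SkewPoly.coeff_map]
  exact τ.apply_symm_apply _

/-- The annihilators of an equivariant family of subspaces form an equivariant family: `τ(G α)` and
`G (τ α)` are monic and divide each other on the right. -/
theorem map_annihilator (H : IsCSCExtension Fq σ σL τ ℓ m) {W : L → Submodule Fq L}
    (hW : IsEquivariant τ ℓ W) {G : L → SkewPoly σL} {d : L → ℕ}
    (hmonic : ∀ α, (G α).IsMonicOfDegree (d α))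
    (hker : ∀ α x, SkewPoly.op σL (G α) x = 0 ↔ x ∈ W α)
    (hdvd : ∀ α f, (∀ x ∈ W α, SkewPoly.op σL f x = 0) → ∃ Q, f = Q * G α) {α : L}
    (hα : α ^ ℓ = 1) : SkewPoly.map σL (τ : L →+* L) (G α) = G (τ α) := by
  obtain ⟨u, hu⟩ := hdvd (τ α) (SkewPoly.map σL (τ : L →+* L) (G α)) fun x hx => by
    obtain ⟨y, rfl⟩ := τ.surjective x
    have := SkewPoly.op_map σL (τ := (τ : L →+* L)) H.comm (G α) y
    rw [(hker α y).2 ((hW α hα y).1 hx), _root_.map_zero] at this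
    exact this
  obtain ⟨v, hv⟩ := hdvd α (SkewPoly.map σL (τ.symm : L →+* L) (G (τ α))) fun x hx => by
    have := SkewPoly.op_map σL (τ := (τ.symm : L →+* L)) H.comm_symm (G (τ α)) (τ x)
    rw [(hker (τ α) (τ x)).2 ((hW α hα x).2 hx), _root_.map_zero] at this
    simpa using this
  refine SkewPoly.eq_of_left_associated (map_isMonicOfDegree _ _ (hmonic α)) (hmonic (τ α)) hu
    (v := SkewPoly.map σL (τ : L →+* L) v) ?_
  rw [← SkewPoly.map_mul (π := (τ : L →+* L)) H.comm, ← hv, map_symm_map]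

theorem finiteDimensional (H : IsCSCExtension Fq σ σL τ ℓ m) : FiniteDimensional Fq L :=
  FiniteDimensional.of_finrank_pos (by rw [H.finrank_eq]; exact H.pos)

/-- `dim W (τ α) = dim W α`, although `τ` is not `Fq`-linear: both are the degree of the
annihilator, which `τ` preserves. -/
theorem finrank_equivariant (H : IsCSCExtension Fq σ σL τ ℓ m) {W : L → Submodule Fq L}
    (hW : IsEquivariant τ ℓ W) {α : L} (hα : α ^ ℓ = 1) :
    Module.finrank Fq (W (τ α)) = Module.finrank Fq (W α) := by
  have := H.finiteDimensional
  choose G hmonic hker hdvd using fun α => SkewPoly.exists_annihilator H.fixed_sigma (W α)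
  refine (hmonic (τ α)).degree_unique ?_
  rw [← H.map_annihilator hW hmonic hker hdvd hα]
  exact map_isMonicOfDegree _ _ (hmonic α)

/-- An equivariant family `W` of subspaces is the family of kernels of a skew polynomial `g` over
`𝒮`, which is monic at each root of unity, divides `z ^ m - 1`, and divides on the right every skew
polynomial that vanishes on `W`. -/
theorem exists_generator (H : IsCSCExtension Fq σ σL τ ℓ m) {W : L → Submodule Fq L}
    (hW : IsEquivariant τ ℓ W) :
    ∃ g h : SkewPoly (cycSigma σ ℓ),
      g * h = SkewPolynomial.X ^ m - 1 ∧ h * g = SkewPolynomial.X ^ m - 1 ∧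
      (∀ (α : L) (hα : α ^ ℓ = 1), (∃ d, (evalRoot σL hα g).IsMonicOfDegree d) ∧
        (∃ d, (evalRoot σL hα h).IsMonicOfDegree d) ∧
        ∀ x, SkewPoly.op σL (evalRoot σL hα g) x = 0 ↔ x ∈ W α) ∧
      ∀ f : SkewPoly (cycSigma σ ℓ),
        (∀ (α : L) (hα : α ^ ℓ = 1), ∀ x ∈ W α, SkewPoly.op σL (evalRoot σL hα f) x = 0) →
        ∃ Q, f = Q * g := by
  have := H.finiteDimensional
  choose G hmonic hker hdvd using fun α => SkewPoly.exists_annihilator H.fixed_sigma (W α)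
  have hG := fun {α} => H.map_annihilator hW hmonic hker hdvd (α := α)
  obtain ⟨g, hg⟩ := H.exists_skewPoly G fun α hα => hG hα
  have hdvd' : ∀ f : SkewPoly (cycSigma σ ℓ),
      (∀ (α : L) (hα : α ^ ℓ = 1), ∀ x ∈ W α, SkewPoly.op σL (evalRoot σL hα f) x = 0) →
      ∃ Q, f = Q * g := by
    intro f hf
    have hex : ∀ α : L, ∃ Q : SkewPoly σL, ∀ hα : α ^ ℓ = 1, evalRoot σL hα f = Q * G α := by
      intro α
      by_cases hα : α ^ ℓ = 1
      · obtain ⟨Q, hQ⟩ := hdvd α _ (hf α hα)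
        exact ⟨Q, fun _ => hQ⟩
      · exact ⟨0, fun h => absurd h hα⟩
    choose Q hQ using hex
    obtain ⟨q, hq⟩ := H.exists_skewPoly Q fun α hα => by
      refine SkewPoly.mul_right_cancel_of_monic (hmonic (τ α)) ?_
      rw [← hG hα, ← SkewPoly.map_mul (π := (τ : L →+* L)) H.comm, ← hQ α hα, map_evalRoot,
        hQ (τ α) (pow_eq_one_of_algEquiv τ hα), hG hα]
    refine ⟨q, H.skewPoly_ext fun α hα => ?_⟩
    rw [hQ α hα, H.evalRoot_mul, hq, hg]
  have hX : ∀ {α : L} (hα : α ^ ℓ = 1),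
      evalRoot σL hα (SkewPolynomial.X ^ m - 1 : SkewPoly (cycSigma σ ℓ)) =
        SkewPolynomial.X ^ m - 1 := fun hα => by
    rw [evalRoot, SkewPoly.map_sub, SkewPoly.map_X_pow, SkewPoly.map_one]
  obtain ⟨h, hh⟩ := hdvd' (SkewPolynomial.X ^ m - 1) fun α hα x _ => by
    rw [hX, SkewPoly.op_sub, SkewPoly.op_X_pow, SkewPoly.op_one, H.sigma_iterate, sub_self]
  -- `z ^ m - 1` is central in `L[z; σL]`, so `h g = z ^ m - 1` gives `(g h) g = (z ^ m - 1) g`.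
  refine ⟨g, h, H.skewPoly_ext fun α hα => ?_, hh.symm, fun α hα => ⟨⟨_, hg α hα ▸ hmonic α⟩, ?_,
    fun x => by rw [hg α hα, hker]⟩, hdvd'⟩
  · refine SkewPoly.mul_right_cancel_of_monic (hmonic α) ?_
    rw [← hg α hα, hX, ← SkewPoly.X_pow_sub_one_mul_comm H.sigma_iterate, ← H.evalRoot_mul,
      mul_assoc, ← hh, H.evalRoot_mul, hX]
  · have hm := SkewPoly.IsMonicOfDegree.X_pow_sub_one (σ := σL) H.pos
    rw [← hX hα, hh, H.evalRoot_mul] at hm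
    obtain ⟨d, hd, -⟩ := hm.of_mul (hg α hα ▸ hmonic α)
    exact ⟨d, hd⟩

end IsCSCExtension

end Descent

/-! ### Minimal generators of cyclic-skew-cyclic codes -/

section Code

variable {Fq F L : Type*} [Field F] [Field Fq] [Field L] [Algebra F L] [Algebra Fq L]
  {σ : F →+* F} {σL : L →+* L} {τ : L ≃ₐ[F] L} {ℓ m : ℕ}

/-- The representative of `ν(c)` in `𝒮[z; σ]` of degree less than `m` in `z`. -/
noncomputable def codePoly (σ : F →+* F) (c : Fin ℓ × Fin m → F) : SkewPoly (cycSigma σ ℓ) :=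
  ∑ j : Fin m, SkewPoly.monomial (cycSigma σ ℓ) j
    (AdjoinRoot.mk (X ^ ℓ - 1) (∑ i : Fin ℓ, C (c (i, j)) * X ^ (i : ℕ)))

theorem nu_eq (σ : F →+* F) (c : Fin ℓ × Fin m → F) :
    nu σ c = toCSCRing σ ℓ m (codePoly σ c) := rfl

/-- The value at `x` of the operator `∑_j c_j(α) σ ^ j`, where `c_j(α) = ∑_i c^{(i)}_j α ^ i`. -/
def codeEval (σL : L →+* L) (α : L) (c : Fin ℓ × Fin m → L) (x : L) : L :=
  ∑ j : Fin m, (∑ i : Fin ℓ, c (i, j) * α ^ (i : ℕ)) * σL^[j] x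

theorem op_evalRoot_codePoly {α : L} (hα : α ^ ℓ = 1) (c : Fin ℓ × Fin m → F) (x : L) :
    SkewPoly.op σL (evalRoot σL hα (codePoly σ c)) x =
      codeEval σL α (fun ij => algebraMap F L (c ij)) x := by
  have h : evalRoot σL hα (codePoly σ c) = ∑ j : Fin m, SkewPoly.monomial σL j
      (∑ i : Fin ℓ, algebraMap F L (c (i, j)) * α ^ (i : ℕ)) := by
    refine SkewPoly.ext' fun k => ?_
    rw [SkewPoly.coeff_map, codePoly, SkewPoly.coeff_sum, SkewPoly.coeff_sum, map_sum]
    refine Finset.sum_congr rfl fun j _ => ?_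
    rw [SkewPoly.coeff_monomial, SkewPoly.coeff_monomial]
    split_ifs
    · rw [cycEval_mk]; simp
    · exact _root_.map_zero _
  rw [h, SkewPoly.op_sum_monomial]
  rfl

/-- The code of the words that vanish on a family `W` of subspaces indexed by the `ℓ`th roots of
unity. -/
def IsVanishingCode (σL : L →+* L) (W : L → Submodule Fq L)
    (D : Submodule F (Fin ℓ × Fin m → F)) : Prop :=
  ∀ c, c ∈ D ↔ ∀ α : L, α ^ ℓ = 1 → ∀ x ∈ W α,
    codeEval σL α (fun ij => algebraMap F L (c ij)) x = 0

theorem toCSCRing_eq_iff (f g : SkewPoly (cycSigma σ ℓ)) :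
    toCSCRing σ ℓ m f = toCSCRing σ ℓ m g ↔ ∃ P, f = g + P * (SkewPolynomial.X ^ m - 1) := by
  rw [toCSCRing, Submodule.mkQ_apply, Submodule.mkQ_apply, Submodule.Quotient.eq,
    Ideal.mem_span_singleton']
  exact exists_congr fun P => by rw [eq_comm, sub_eq_iff_eq_add']

theorem codePoly_add (c c' : Fin ℓ × Fin m → F) :
    codePoly σ (c + c') = codePoly σ c + codePoly σ c' := by
  rw [codePoly, codePoly, codePoly, ← Finset.sum_add_distrib]
  refine Finset.sum_congr rfl fun j _ => ?_
  rw [← SkewPoly.monomial_add, ← _root_.map_add, ← Finset.sum_add_distrib]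
  congr 2
  exact Finset.sum_congr rfl fun i _ => by rw [Pi.add_apply, C_add, add_mul]

theorem exists_mk_sum (hℓ : 0 < ℓ) (r : CycRing F ℓ) :
    ∃ v : Fin ℓ → F, r = AdjoinRoot.mk _ (∑ i : Fin ℓ, C (v i) * X ^ (i : ℕ)) := by
  obtain ⟨p, rfl⟩ := AdjoinRoot.mk_surjective r
  have hmonic : (X ^ ℓ - 1 : F[X]).Monic := by
    simpa using monic_X_pow_sub_C (1 : F) hℓ.ne'
  refine ⟨fun i => (p %ₘ (X ^ ℓ - 1)).coeff i, ?_⟩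
  have hsum := sum_modByMonic_coeff hmonic (p := p) (n := ℓ)
    (by simpa using (degree_X_pow_sub_C hℓ (1 : F)).le)
  simp only [← C_mul_X_pow_eq_monomial] at hsum
  rw [hsum, AdjoinRoot.mk_eq_mk]
  exact ⟨p /ₘ (X ^ ℓ - 1), sub_eq_iff_eq_add'.2 (modByMonic_add_div p (X ^ ℓ - 1)).symm⟩

/-- Every class in `ℛ` is `ν(c)` for some word `c`. -/
theorem exists_codePoly_add (hℓ : 0 < ℓ) (hm : 0 < m) (f : SkewPoly (cycSigma σ ℓ)) :
    ∃ (c : Fin ℓ × Fin m → F) (P : SkewPoly (cycSigma σ ℓ)),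
      f = codePoly σ c + P * (SkewPolynomial.X ^ m - 1) := by
  induction f using SkewPoly.induction_on with
  | hadd f g hf hg =>
    obtain ⟨c, P, rfl⟩ := hf
    obtain ⟨c', P', rfl⟩ := hg
    exact ⟨c + c', P + P', by rw [codePoly_add, add_mul]; abel⟩
  | hmon n r =>
    induction n using Nat.strong_induction_on with
    | _ n ih =>
      by_cases hn : n < m
      · obtain ⟨v, rfl⟩ := exists_mk_sum hℓ r
        refine ⟨fun ij => if ij.2 = ⟨n, hn⟩ then v ij.1 else 0, 0, ?_⟩
        rw [zero_mul, add_zero, codePoly, Finset.sum_eq_single (⟨n, hn⟩ : Fin m)]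
        · simp
        · intro j _ hj
          simp [hj, SkewPoly.monomial_zero]
        · simp
      · obtain ⟨c, P, hP⟩ := ih (n - m) (by omega)
        refine ⟨c, P + SkewPoly.monomial _ (n - m) r, ?_⟩
        rw [add_mul, ← add_assoc, ← hP, mul_sub, mul_one, ← SkewPoly.monomial_one_right,
          SkewPoly.monomial_mul_monomial, iterate_map_one, mul_one,
          Nat.sub_add_cancel (not_lt.1 hn), add_sub_cancel]

/-- The projection modulo `μ` can be tested at a zero `α` of `μ`, as `F[x]/(μ)` embeds in `L`. -/
theorem isMonicAlong_cycProj_iff {μ : F[X]} (hμ : μ ∣ X ^ ℓ - 1) (hirr : Irreducible μ) {α : L}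
    (hα : α ^ ℓ = 1) (hroot : aeval α μ = 0) (f : SkewPoly (cycSigma σ ℓ)) :
    f.IsMonicAlong (cycProj μ hμ) ↔ ∃ d, (evalRoot σL hα f).IsMonicOfDegree d := by
  have : Fact (Irreducible μ) := ⟨hirr⟩
  let φ : AdjoinRoot μ →+* L := AdjoinRoot.lift (algebraMap F L) α hroot
  have hφ : ∀ r : CycRing F ℓ, φ (cycProj μ hμ r) = cycEval α hα r := by
    refine RingHom.congr_fun (f := φ.comp (cycProj μ hμ)) (AdjoinRoot.ringHom_ext ?_ ?_)
    · ext x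
      simp only [cycEval, cycProj, RingHom.comp_apply, AdjoinRoot.map_of, AdjoinRoot.lift_of]
      exact AdjoinRoot.lift_of hroot
    · simp only [cycEval, cycProj, RingHom.comp_apply, AdjoinRoot.map_root, AdjoinRoot.lift_root]
      exact AdjoinRoot.lift_root hroot
  rw [← SkewPoly.isMonicAlong_iff]
  refine exists_congr fun d => and_congr ?_ (forall₂_congr fun k _ => ?_)
  · rw [← hφ, ← φ.injective.eq_iff, _root_.map_one]
  · rw [← hφ, ← φ.injective.eq_iff, _root_.map_zero]

/-- Since `z ^ m - 1` is a left multiple of each minimal generator, two of them are left multiples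
of each other already in `𝒮[z; σ]`. -/
theorem IsMinimalGenerator.exists_eq_mul {D : Submodule F (Fin ℓ × Fin m → F)}
    {g g' : SkewPoly (cycSigma σ ℓ)} (hg : IsMinimalGenerator σ D g)
    (hg' : IsMinimalGenerator σ D g') : ∃ u, g = u * g' := by
  obtain ⟨h', -, hh', -⟩ := hg'.2
  have hmem : toCSCRing σ ℓ m g ∈
      Submodule.span (SkewPoly (cycSigma σ ℓ)) {toCSCRing σ ℓ m g'} := by
    rw [← SetLike.mem_coe, ← hg'.1, hg.1]
    exact Submodule.subset_span rfl
  obtain ⟨u, hu⟩ := Submodule.mem_span_singleton.1 hmem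
  rw [← _root_.map_smul, eq_comm, toCSCRing_eq_iff] at hu
  obtain ⟨P, hP⟩ := hu
  exact ⟨u + P * h', by rw [hP, smul_eq_mul, add_mul, mul_assoc P, hh']⟩

namespace IsCSCExtension

theorem exists_root_of_dvd (H : IsCSCExtension Fq σ σL τ ℓ m) {μ : F[X]} (hμ : μ ∣ X ^ ℓ - 1)
    (hirr : Irreducible μ) : ∃ α : L, α ^ ℓ = 1 ∧ aeval α μ = 0 := by
  obtain ⟨a, ha⟩ := H.exists_root
  have hs : (μ.map (algebraMap F L)).Splits := by
    refine (X_pow_sub_one_splits ha).of_dvd ?_ ?_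
    · exact (monic_X_pow_sub_C (1 : L) H.ell_pos.ne').ne_zero
    · simpa using Polynomial.map_dvd (algebraMap F L) hμ
  obtain ⟨α, hα⟩ := hs.exists_eval_eq_zero (by
    rw [degree_map]
    exact (degree_pos_of_irreducible hirr).ne')
  rw [eval_map_algebraMap] at hα
  refine ⟨α, ?_, hα⟩
  have := eval₂_eq_zero_of_dvd_of_eval₂_eq_zero (algebraMap F L) α hμ hα
  simpa [sub_eq_zero] using this

/-- The code that vanishes on an equivariant family of subspaces has a unique minimal generator
skew polynomial, whose kernels form the family. -/
theorem existsUnique_isMinimalGenerator (H : IsCSCExtension Fq σ σL τ ℓ m)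
    {W : L → Submodule Fq L} (hW : IsEquivariant τ ℓ W) {D : Submodule F (Fin ℓ × Fin m → F)}
    (hD : IsVanishingCode σL W D) :
    ∃ g, IsMinimalGenerator σ D g ∧ (∀ g', IsMinimalGenerator σ D g' → g' = g) ∧
      ∀ (α : L) (hα : α ^ ℓ = 1) (x : L),
        SkewPoly.op σL (evalRoot σL hα g) x = 0 ↔ x ∈ W α := by
  obtain ⟨g, h, hgh, hhg, hroot, hdvd⟩ := H.exists_generator hW
  have hmin : IsMinimalGenerator σ D g := by
    refine ⟨Set.Subset.antisymm ?_ ?_, h, hgh, hhg, fun μ hμ hirr => ?_⟩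
    · rintro _ ⟨c, hc, rfl⟩
      obtain ⟨Q, hQ⟩ := hdvd (codePoly σ c) fun α hα x hx => by
        rw [op_evalRoot_codePoly]
        exact (hD c).1 hc α hα x hx
      rw [nu_eq, hQ, ← smul_eq_mul, _root_.map_smul]
      exact Submodule.smul_mem _ _ (Submodule.subset_span rfl)
    · intro y hy
      obtain ⟨Q, rfl⟩ := Submodule.mem_span_singleton.1 hy
      obtain ⟨c, P, hP⟩ := exists_codePoly_add H.ell_pos H.pos (Q * g)
      refine ⟨c, (hD c).2 fun α hα x hx => ?_, ?_⟩
      · have hc : codePoly σ c = (Q - P * h) * g := by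
          rw [sub_mul, mul_assoc P, hhg, hP, add_sub_cancel_right]
        rw [← op_evalRoot_codePoly (σ := σ) hα, hc, H.evalRoot_mul, SkewPoly.op_mul,
          ((hroot α hα).2.2 x).2 hx, _root_.map_zero]
      · rw [nu_eq, ← _root_.map_smul, eq_comm, toCSCRing_eq_iff]
        exact ⟨P, hP⟩
    · obtain ⟨α, hα, hμα⟩ := H.exists_root_of_dvd hμ hirr
      rw [isMonicAlong_cycProj_iff (σL := σL) hμ hirr hα hμα,
        isMonicAlong_cycProj_iff (σL := σL) hμ hirr hα hμα]
      exact ⟨(hroot α hα).1, (hroot α hα).2.1⟩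
  refine ⟨g, hmin, fun g' hg' => ?_, fun α hα => (hroot α hα).2.2⟩
  obtain ⟨u, hu⟩ := hg'.exists_eq_mul hmin
  obtain ⟨v, hv⟩ := hmin.exists_eq_mul hg'
  refine H.skewPoly_ext fun α hα => ?_
  obtain ⟨d, hd⟩ := (hroot α hα).1
  have hroot' : aeval α (X ^ ℓ - 1 : F[X]) = 0 := by simp [hα]
  have hint : IsIntegral F α :=
    ⟨X ^ ℓ - 1, by simpa using monic_X_pow_sub_C (1 : F) H.ell_pos.ne', hroot'⟩
  obtain ⟨h', -, -, hmon⟩ := hg'.2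
  obtain ⟨d', hd'⟩ := (isMonicAlong_cycProj_iff (σL := σL) (minpoly.dvd F α hroot')
    (minpoly.irreducible hint) hα (minpoly.aeval F α) g').1
      (hmon _ (minpoly.dvd F α hroot') (minpoly.irreducible hint)).1
  exact SkewPoly.eq_of_left_associated hd' hd (by rw [← H.evalRoot_mul, ← hu])
    (by rw [← H.evalRoot_mul, ← hv])

/-- The partial defining sets of the code that vanishes on the equivariant family `W` are the
nonzero elements of the members of `W`. -/
theorem partialDefiningSet_eq (H : IsCSCExtension Fq σ σL τ ℓ m)
    {W : L → Submodule Fq L} (hW : IsEquivariant τ ℓ W) {D : Submodule F (Fin ℓ × Fin m → F)}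
    (hD : IsVanishingCode σL W D) {a : Fq} (ha : (algebraMap Fq L a) ^ ℓ = 1) :
    partialDefiningSet L σ σL D a = (W (algebraMap Fq L a) : Set L) \ {0} := by
  obtain ⟨g, hg, huniq, hker⟩ := H.existsUnique_isMinimalGenerator hW hD
  have hgen : minimalGenerator σ D = g := by
    have hex : ∃ g, IsMinimalGenerator σ D g := ⟨g, hg⟩
    rw [minimalGenerator, dif_pos hex]
    exact huniq _ hex.choose_spec
  ext γ
  simp only [partialDefiningSet, definingSet, Set.mem_ofPred_eq, hgen, Set.mem_sdiff,
    Set.mem_singleton_iff, SetLike.mem_coe]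
  rw [and_comm]
  refine and_congr_left fun hγ => ?_
  rw [← hker _ ha, SkewPoly.op_eq_zero_iff hγ]
  constructor
  · rintro ⟨_, h⟩
    rw [totalEval, Submodule.Quotient.mk_eq_zero, Ideal.mem_span_singleton'] at h
    obtain ⟨Q, hQ⟩ := h
    exact ⟨Q, hQ.symm⟩
  · rintro ⟨Q, hQ⟩
    refine ⟨ha, ?_⟩
    rw [totalEval, Submodule.Quotient.mk_eq_zero, Ideal.mem_span_singleton']
    exact ⟨Q, hQ.symm⟩

end IsCSCExtension

end Code

/-! ### Galois descent for subfield subcodes -/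

section GaloisDescent

variable {F L : Type*} [Field F] [Field L] [Algebra F L] {ι κ : Type*}

/-- Vectors over `F` that are independent over `F` remain independent over `L`. -/
theorem linearIndependent_algebraMap_comp [Fintype κ] {v : κ → ι → F}
    (hv : LinearIndependent F v) :
    LinearIndependent L (fun k i => algebraMap F L (v k i)) := by
  rw [Fintype.linearIndependent_iff] at hv ⊢
  intro g hg k
  let B := Module.Free.chooseBasis F L
  refine B.ext_elem fun l => ?_
  rw [_root_.map_zero, Finsupp.zero_apply]
  refine hv (fun k => B.repr (g k) l) ?_ k
  ext i
  have h := congrFun hg i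
  simp only [Finset.sum_apply, Pi.smul_apply, smul_eq_mul, Pi.zero_apply] at h ⊢
  have h' := congrArg (fun x => B.coord l x) h
  simp only [map_sum, _root_.map_zero] at h'
  rw [← h']
  refine Finset.sum_congr rfl fun k _ => ?_
  rw [mul_comm (g k), ← Algebra.smul_def, _root_.map_smul, smul_eq_mul, mul_comm]
  rfl

/-- A Galois-stable `L`-subspace of `L ^ n` is spanned by its `F`-rational vectors: a linear form
that vanishes on all traces `∑_g g(x u)` vanishes on `u`, by the independence of characters. -/
theorem span_subfieldSubcode [FiniteDimensional F L] [IsGalois F L] [Fintype ι]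
    (U : Submodule L (ι → L)) (hU : ∀ (g : L ≃ₐ[F] L), ∀ u ∈ U, (fun i => g (u i)) ∈ U) :
    Submodule.span L {w | ∃ c ∈ subfieldSubcode F U, w = fun i => algebraMap F L (c i)} = U := by
  refine le_antisymm (Submodule.span_le.2 ?_) fun u hu => ?_
  · rintro _ ⟨c, hc, rfl⟩
    exact hc
  · by_contra hn
    obtain ⟨φ, hφ, hker⟩ := Submodule.exists_le_ker_of_notMem hn
    have htr : ∀ x : L, ∑ g : L ≃ₐ[F] L, φ (fun i => g (u i)) * g x = 0 := by
      intro x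
      have hsum : (fun i => algebraMap F L (Algebra.trace F L (x * u i))) =
          ∑ g : L ≃ₐ[F] L, g x • fun i => g (u i) := by
        ext i
        rw [trace_eq_sum_automorphisms, Finset.sum_apply]
        exact Finset.sum_congr rfl fun g _ => by simp
      have hmem : (fun i => algebraMap F L (Algebra.trace F L (x * u i))) ∈ U := by
        rw [hsum]
        exact Submodule.sum_mem _ fun g _ => U.smul_mem _ (hU g u hu)
      have h0 := hker (Submodule.subset_span ⟨_, hmem, rfl⟩)
      rw [LinearMap.mem_ker, hsum, map_sum] at h0
      rw [← h0]
      exact Finset.sum_congr rfl fun g _ => by rw [_root_.map_smul, smul_eq_mul, mul_comm]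
    have hind : LinearIndependent L (fun g : L ≃ₐ[F] L => ((g : L →* L) : L → L)) :=
      (linearIndependent_monoidHom L L).comp (fun g : L ≃ₐ[F] L => (g : L →* L))
        fun g g' h => AlgEquiv.ext fun x => DFunLike.congr_fun h x
    rw [Fintype.linearIndependent_iff] at hind
    refine hφ (hind (fun g => φ fun i => g (u i)) ?_ 1)
    ext x
    simpa using htr x

theorem finrank_subfieldSubcode [FiniteDimensional F L] [IsGalois F L] [Fintype ι]
    (U : Submodule L (ι → L)) (hU : ∀ (g : L ≃ₐ[F] L), ∀ u ∈ U, (fun i => g (u i)) ∈ U) :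
    Module.finrank F (subfieldSubcode F U) = Module.finrank L U := by
  let B := Module.finBasis F (subfieldSubcode F U)
  have hB : LinearIndependent F (fun k => (B k : ι → F)) :=
    B.linearIndependent.map' (Submodule.subtype _) (Submodule.ker_subtype _)
  have hspan : Submodule.span L (Set.range fun k i => algebraMap F L ((B k : ι → F) i)) = U := by
    conv_rhs => rw [← span_subfieldSubcode U hU]
    refine le_antisymm (Submodule.span_le.2 ?_) (Submodule.span_le.2 ?_)
    · rintro _ ⟨k, rfl⟩
      exact Submodule.subset_span ⟨_, (B k).2, rfl⟩
    · rintro _ ⟨c, hc, rfl⟩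
      have hc' : c = ∑ k, B.repr ⟨c, hc⟩ k • (B k : ι → F) := by
        refine (congrArg (Submodule.subtype _) (B.sum_repr ⟨c, hc⟩)).symm.trans ?_
        exact map_sum (Submodule.subtype _) _ _
      have : (fun i => algebraMap F L (c i)) = ∑ k, algebraMap F L (B.repr ⟨c, hc⟩ k) •
          fun i => algebraMap F L ((B k : ι → F) i) := by
        ext i
        conv_lhs => rw [hc']
        simp [Algebra.smul_def]
      rw [this]
      exact Submodule.sum_mem _ fun k _ => Submodule.smul_mem _ _ (Submodule.subset_span ⟨k, rfl⟩)
  have := finrank_span_eq_card (linearIndependent_algebraMap_comp (L := L) hB)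
  rw [hspan, Fintype.card_fin] at this
  exact this.symm

end GaloisDescent

/-! ### The dimension of a cyclic-skew-cyclic code -/

section Dimension

variable {Fq F L : Type*} [Field F] [Field Fq] [Field L] [Algebra F L] [Algebra Fq L]
  {σ : F →+* F} {σL : L →+* L} {τ : L ≃ₐ[F] L} {ℓ m : ℕ}

theorem finRotate_val {N : ℕ} (i : Fin N) : (finRotate N i : ℕ) = (i + 1) % N := by
  cases N with
  | zero => exact i.elim0
  | succ N => 
    rw [coe_finRotate]
    split_ifs with h
    · rw [h, Fin.val_last, Nat.mod_self]
    · rw [Nat.mod_eq_of_lt (Nat.succ_lt_succ (Fin.val_lt_last h))]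

/-- The inter-block shift multiplies `c(α, z)` by `α`. -/
theorem codeEval_interShift {α : L} (hα : α ^ ℓ = 1) (c : Fin ℓ × Fin m → L) (x : L) :
    codeEval σL α (interShift c) x = α * codeEval σL α c x := by
  rw [codeEval, codeEval, Finset.mul_sum]
  refine Finset.sum_congr rfl fun j _ => ?_
  rw [← mul_assoc, Finset.mul_sum, ← Equiv.sum_comp (finRotate ℓ)]
  congr 1
  refine Finset.sum_congr rfl fun i _ => ?_
  rw [interShift, Equiv.symm_apply_apply, finRotate_val, ← pow_eq_pow_mod _ hα, pow_succ]
  ring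

/-- The intra-block shift composes the operator `c(α, σ)` with `σ`. -/
theorem codeEval_intraShift {α : L} (hα : σL α = α) (hσ : ∀ x, σL^[m] x = x)
    (c : Fin ℓ × Fin m → L) (x : L) :
    codeEval σL α (intraShift σL c) x = σL (codeEval σL α c x) := by
  rw [codeEval, codeEval, map_sum, ← Equiv.sum_comp (finRotate m)]
  refine Finset.sum_congr rfl fun j _ => ?_
  rw [_root_.map_mul, map_sum, finRotate_val,
    Function.IsPeriodicPt.iterate_mod_apply (f := σL) (x := x) (hσ x), Function.iterate_succ_apply']
  congr 1
  refine Finset.sum_congr rfl fun i _ => ?_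
  rw [intraShift, Equiv.symm_apply_apply, _root_.map_mul, _root_.map_pow, hα]

theorem codeEval_map (hτ : ∀ x, τ (σL x) = σL (τ x)) (α : L) (c : Fin ℓ × Fin m → L) (x : L) :
    codeEval σL (τ α) (fun ij => τ (c ij)) (τ x) = τ (codeEval σL α c x) := by
  simp only [codeEval, map_sum, _root_.map_mul, _root_.map_pow]
  refine Finset.sum_congr rfl fun j _ => ?_
  rw [(Function.Semiconj.iterate_right (f := τ) hτ j).eq]

namespace IsCSCExtension

theorem isCSC (H : IsCSCExtension Fq σ σL τ ℓ m) {W : L → Submodule Fq L}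
    {D : Submodule F (Fin ℓ × Fin m → F)} (hD : IsVanishingCode σL W D) : IsCSC σ D := by
  refine fun c hc => ⟨(hD _).2 fun α hα x hx => ?_, (hD _).2 fun α hα x hx => ?_⟩
  · have := codeEval_interShift (σL := σL) hα (fun ij => algebraMap F L (c ij)) x
    rw [(hD c).1 hc α hα x hx, mul_zero] at this
    exact this
  · have := codeEval_intraShift (H.root_fixed α hα) H.sigma_iterate
      (fun ij => algebraMap F L (c ij)) x
    rw [(hD c).1 hc α hα x hx, _root_.map_zero] at this
    rw [← this]
    congr 1
    ext ij
    exact H.map_sigma _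

/-- `σL` as an endomorphism of the `Fq`-algebra `L`. -/
def sigmaAlgHom (H : IsCSCExtension Fq σ σL τ ℓ m) : L →ₐ[Fq] L :=
  { σL with commutes' := fun y => (H.fixed_sigma _).2 ⟨y, rfl⟩ }

theorem sigmaAlgHom_pow_apply (H : IsCSCExtension Fq σ σL τ ℓ m) (k : ℕ) (x : L) :
    (H.sigmaAlgHom ^ k) x = σL^[k] x := by
  rw [AlgHom.coe_pow]; rfl

/-- All the operators `c(α, σ)` of a word `c`, for `α ^ ℓ = 1`. -/
noncomputable def allEval (H : IsCSCExtension Fq σ σL τ ℓ m) :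
    (Fin ℓ × Fin m → L) →ₗ[L] (nthRootsFinset ℓ (1 : L)) → (L →ₗ[Fq] L) where
  toFun c α := ∑ j : Fin m, (∑ i : Fin ℓ, c (i, j) * (α : L) ^ (i : ℕ)) •
    (H.sigmaAlgHom ^ (j : ℕ)).toLinearMap
  map_add' c c' := by
    ext α : 1
    simp [add_mul, Finset.sum_add_distrib, add_smul]
  map_smul' r c := by
    ext α : 1
    simp [mul_assoc, ← Finset.mul_sum, mul_smul, ← Finset.smul_sum]

theorem allEval_apply (H : IsCSCExtension Fq σ σL τ ℓ m) (c : Fin ℓ × Fin m → L)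
    (α : nthRootsFinset ℓ (1 : L)) (x : L) : H.allEval c α x = codeEval σL α c x := by
  simp [allEval, codeEval, ← sigmaAlgHom_pow_apply H]

theorem linearIndependent_sigma_pow (H : IsCSCExtension Fq σ σL τ ℓ m) :
    LinearIndependent L (fun j : Fin m => (H.sigmaAlgHom ^ (j : ℕ)).toLinearMap) := by
  refine (linearIndependent_toLinearMap Fq L L).comp (fun j : Fin m => H.sigmaAlgHom ^ (j : ℕ)) ?_
  have key : ∀ i j : Fin m, i ≤ j → H.sigmaAlgHom ^ (i : ℕ) = H.sigmaAlgHom ^ (j : ℕ) → i = j := by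
    intro i j hij h
    have h0 := H.sigma_order (j - i) (by omega) fun x => by
      refine (σL.injective.iterate i) ?_
      have := DFunLike.congr_fun h x
      rw [sigmaAlgHom_pow_apply, sigmaAlgHom_pow_apply] at this
      rw [← Function.iterate_add_apply, this]
      congr 2
      have : (i : ℕ) ≤ j := hij
      omega
    have : (i : ℕ) ≤ j := hij
    exact Fin.ext (by omega)
  intro i j h
  rcases le_total i j with hij | hij
  · exact key i j hij h
  · exact (key j i hij h.symm).symm

/-- The powers of `σL` are independent over `L`, and a polynomial of degree less than `ℓ` that
vanishes at the `ℓ`th roots of unity is zero. -/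
theorem allEval_injective (H : IsCSCExtension Fq σ σL τ ℓ m) :
    Function.Injective H.allEval := by
  rw [← LinearMap.ker_eq_bot, LinearMap.ker_eq_bot']
  intro c hc
  ext ⟨i, j⟩
  have h1 : ∀ α ∈ nthRootsFinset ℓ (1 : L), ∑ i : Fin ℓ, c (i, j) * α ^ (i : ℕ) = 0 := by
    intro α hα
    exact Fintype.linearIndependent_iff.1 H.linearIndependent_sigma_pow _
      (congrFun hc ⟨α, hα⟩) j
  let p : L[X] := ∑ i : Fin ℓ, C (c (i, j)) * X ^ (i : ℕ)
  have hp : p = 0 := by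
    refine eq_zero_of_degree_lt_of_eval_finset_eq_zero (nthRootsFinset ℓ (1 : L)) ?_ fun α hα => ?_
    · rw [H.card_roots]
      exact degree_sum_fin_lt _
    · rw [← h1 α hα]
      simp [p, eval_finsetSum]
  have := congrArg (fun p => coeff p i) hp
  simpa [p, finsetSum_coeff, coeff_C_mul, coeff_X_pow, Fin.val_inj] using this

theorem allEval_surjective (H : IsCSCExtension Fq σ σL τ ℓ m) :
    Function.Surjective H.allEval := by
  have := H.finiteDimensional
  have : Module.Finite L (L →ₗ[Fq] L) := inferInstance
  refine (LinearMap.injective_iff_surjective_of_finrank_eq_finrank ?_).1 H.allEval_injective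
  rw [Module.finrank_fintype_fun_eq_card, Module.finrank_pi_fintype]
  simp [Module.finrank_linearMap, H.finrank_eq, H.card_roots]

/-- The operators `c(α, σ)` of a word `c`, restricted to the members of `W`. -/
noncomputable def restrictedEval (H : IsCSCExtension Fq σ σL τ ℓ m) (W : L → Submodule Fq L) :
    (Fin ℓ × Fin m → L) →ₗ[L] (α : nthRootsFinset ℓ (1 : L)) → (W α →ₗ[Fq] L) :=
  (LinearMap.pi fun α : nthRootsFinset ℓ (1 : L) =>
    (LinearMap.lcomp L L (W α).subtype).comp (LinearMap.proj α)).comp H.allEval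

theorem finrank_vanishing (H : IsCSCExtension Fq σ σL τ ℓ m) (W : L → Submodule Fq L) :
    Module.finrank L (LinearMap.ker (H.restrictedEval W)) +
      ∑ α ∈ nthRootsFinset ℓ (1 : L), Module.finrank Fq (W α) = ℓ * m := by
  have := H.finiteDimensional
  have hsurj : Function.Surjective (H.restrictedEval W) := by
    intro f
    choose φ hφ using fun α => LinearMap.exists_extend (f α)
    obtain ⟨c, hc⟩ := H.allEval_surjective φ
    refine ⟨c, ?_⟩
    ext α : 1
    rw [← hφ α, ← hc]
    rfl
  have h := LinearMap.finrank_range_add_finrank_ker (H.restrictedEval W)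
  rw [LinearMap.range_eq_top.2 hsurj, finrank_top, Module.finrank_pi_fintype] at h
  simp only [Module.finrank_linearMap, Module.finrank_self, mul_one, Module.finrank_pi,
    Fintype.card_prod, Fintype.card_fin] at h
  rw [← h, add_comm, ← Finset.sum_coe_sort]

theorem mem_ker_restrictedEval (H : IsCSCExtension Fq σ σL τ ℓ m) (W : L → Submodule Fq L)
    (c : Fin ℓ × Fin m → L) : c ∈ LinearMap.ker (H.restrictedEval W) ↔
      ∀ α : L, α ^ ℓ = 1 → ∀ x ∈ W α, codeEval σL α c x = 0 := by
  rw [LinearMap.mem_ker]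
  constructor
  · intro h α hα x hx
    rw [← H.allEval_apply c ⟨α, H.mem_roots.2 hα⟩ x]
    exact DFunLike.congr_fun (congrFun h ⟨α, H.mem_roots.2 hα⟩) ⟨x, hx⟩
  · intro h
    ext α x
    refine (H.allEval_apply c α x).trans ?_
    exact h α (H.mem_roots.1 α.2) x x.2

/-- Each root of unity `α` imposes `dim W α` conditions on the code that vanishes on `W`. -/
theorem finrank_add_sum [FiniteDimensional F L] [IsGalois F L]
    (H : IsCSCExtension Fq σ σL τ ℓ m) {W : L → Submodule Fq L} (hW : IsEquivariant τ ℓ W)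
    {D : Submodule F (Fin ℓ × Fin m → F)} (hD : IsVanishingCode σL W D) :
    Module.finrank F D + ∑ α ∈ nthRootsFinset ℓ (1 : L), Module.finrank Fq (W α) = ℓ * m := by
  rw [← H.finrank_vanishing W]
  have hτ : ∀ u ∈ LinearMap.ker (H.restrictedEval W),
      (fun i => τ (u i)) ∈ LinearMap.ker (H.restrictedEval W) := by
    intro u hu
    rw [mem_ker_restrictedEval] at hu ⊢
    intro α hα x hx
    obtain ⟨α, rfl⟩ := τ.surjective α
    obtain ⟨x, rfl⟩ := τ.surjective x
    rw [← _root_.map_pow, map_eq_one_iff τ τ.injective] at hα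
    rw [codeEval_map H.comm, hu α hα x ((hW α hα x).1 hx), _root_.map_zero]
  have hD' : D = subfieldSubcode F (LinearMap.ker (H.restrictedEval W)) := by
    ext c
    exact (hD c).trans (H.mem_ker_restrictedEval W _).symm
  rw [hD', finrank_subfieldSubcode]
  · intro g u hu
    obtain ⟨k, rfl⟩ := H.generates g
    clear * - hτ hu
    induction k with
    | zero => exact hu
    | succ k ih =>
      rw [pow_succ']
      exact hτ _ ih

end IsCSCExtension

end Dimension

/-! ### Orbits of the Frobenius automorphism -/

section MinimalPolynomial

variable {F L : Type*} [Field F] [Field L] [Algebra F L]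

theorem ncard_rootSet_minpoly [FiniteDimensional F L] [IsGalois F L] (x : L) :
    ((minpoly F x).rootSet L).ncard = (minpoly F x).natDegree := by
  classical
  rw [← card_rootSet_eq_natDegree (IsGalois.separable F x) (IsGalois.splits F x),
    Set.ncard_eq_toFinset_card', Set.toFinset_card]

theorem mem_rootSet_minpoly_iff [FiniteDimensional F L] {μ : F[X]} {x y : L}
    (hμ : Irreducible μ) (hx : aeval x μ = 0) :
    y ∈ (minpoly F x).rootSet L ↔ aeval y μ = 0 := by
  have hlc : μ.leadingCoeff⁻¹ ≠ 0 := inv_ne_zero (leadingCoeff_ne_zero.2 hμ.ne_zero)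
  rw [mem_rootSet_of_ne (minpoly.ne_zero (Algebra.IsIntegral.isIntegral x)),
    ← minpoly.eq_of_irreducible hμ hx, _root_.map_mul, aeval_C, mul_eq_zero,
    or_iff_left ((_root_.map_ne_zero _).2 hlc)]

end MinimalPolynomial

section Frobenius

variable (F : Type*) {L : Type*} [Field F] [Fintype F] [Field L] [Finite L] [Algebra F L]

/-- The automorphism `x ↦ x ^ |F|` of `L / F`. -/
noncomputable abbrev frob (L : Type*) [Field L] [Finite L] [Algebra F L] : L ≃ₐ[F] L :=
  FiniteField.frobeniusAlgEquivOfAlgebraic F L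

theorem frob_iterate_apply (n : ℕ) (x : L) : (frob F L)^[n] x = x ^ Fintype.card F ^ n := by
  rw [FiniteField.coe_frobeniusAlgEquivOfAlgebraic_iterate]

theorem exists_eq_frob_pow (g : L ≃ₐ[F] L) : ∃ k : ℕ, g = frob F L ^ k := by
  obtain ⟨n, hn⟩ := (FiniteField.bijective_frobeniusAlgEquivOfAlgebraic_pow F L).2 g
  exact ⟨n, hn.symm⟩

theorem frob_iterate_finrank (x : L) : (frob F L)^[Module.finrank F L] x = x := by
  have := Fintype.ofFinite L
  rw [frob_iterate_apply, ← Module.card_eq_pow_finrank, FiniteField.pow_card]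

theorem pow_card_eq_self_iff (x : L) :
    x ^ Fintype.card F = x ↔ ∃ y : F, algebraMap F L y = x := by
  constructor
  · intro h
    have hfix : ∀ k : ℕ, (frob F L ^ k) x = x := fun k => by
      rw [AlgEquiv.coe_pow]
      exact Function.iterate_fixed h k
    have hmem : x ∈ (⊥ : IntermediateField F L) := (IsGalois.mem_bot_iff_fixed x).2 fun g => by
      obtain ⟨k, rfl⟩ := exists_eq_frob_pow F g
      exact hfix k
    exact IntermediateField.mem_bot.1 hmem
  · rintro ⟨y, rfl⟩
    rw [← _root_.map_pow, FiniteField.pow_card]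

theorem exists_frob_iterate_iff (x y : L) :
    (∃ k, (frob F L)^[k] x = y) ↔ y ∈ (minpoly F x).rootSet L := by
  rw [← isConjRoot_iff_mem_minpoly_rootSet (Algebra.IsIntegral.isIntegral x),
    show IsConjRoot F x y ↔ IsConjRoot F y x from eq_comm, isConjRoot_iff_exists_algEquiv]
  constructor
  · rintro ⟨k, hk⟩
    exact ⟨frob F L ^ k, by rw [AlgEquiv.coe_pow, hk]⟩
  · rintro ⟨g, hg⟩
    obtain ⟨k, rfl⟩ := exists_eq_frob_pow F g
    exact ⟨k, by rw [← hg, AlgEquiv.coe_pow]⟩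

theorem minimalPeriod_frob_pos (x : L) : 0 < Function.minimalPeriod (frob F L) x :=
  Function.IsPeriodicPt.minimalPeriod_pos Module.finrank_pos (frob_iterate_finrank F x)

/-- The roots of the minimal polynomial of `x` are the conjugates of `x`, listed over one period. -/
theorem rootSet_minpoly_eq (x : L) : (minpoly F x).rootSet L =
    (fun k => (frob F L)^[k] x) '' Set.Iio (Function.minimalPeriod (frob F L) x) := by
  ext y
  rw [← exists_frob_iterate_iff]
  constructor
  · rintro ⟨k, rfl⟩
    exact ⟨_, Nat.mod_lt k (minimalPeriod_frob_pos F x), Function.iterate_mod_minimalPeriod_eq⟩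
  · rintro ⟨k, -, rfl⟩
    exact ⟨k, rfl⟩

/-- The orbit of `x` under the Frobenius automorphism has size the degree of `x`. -/
theorem minimalPeriod_frob (x : L) :
    Function.minimalPeriod (frob F L) x = (minpoly F x).natDegree := by
  rw [← ncard_rootSet_minpoly, rootSet_minpoly_eq,
    Set.InjOn.ncard_image Function.iterate_injOn_Iio_minimalPeriod]
  simp [Set.ncard_eq_toFinset_card']

variable {F} {μ : F[X]} {x y : L}

theorem natDegree_eq_minimalPeriod (hμ : Irreducible μ) (hx : aeval x μ = 0) :
    μ.natDegree = Function.minimalPeriod (frob F L) x := by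
  rw [minimalPeriod_frob, ← minpoly.eq_of_irreducible hμ hx]
  exact (natDegree_mul_C (inv_ne_zero (leadingCoeff_ne_zero.2 hμ.ne_zero))).symm

theorem natDegree_dvd_finrank (hμ : Irreducible μ) (hx : aeval x μ = 0) :
    μ.natDegree ∣ Module.finrank F L := by
  rw [natDegree_eq_minimalPeriod hμ hx]
  exact Function.IsPeriodicPt.minimalPeriod_dvd (frob_iterate_finrank F x)

theorem aeval_frob_iterate (k : ℕ) : aeval ((frob F L)^[k] x) μ = 0 ↔ aeval x μ = 0 := by
  induction k with
  | zero => rfl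
  | succ k ih =>
    rw [Function.iterate_succ_apply', ← ih, aeval_algHom_apply,
      map_eq_zero_iff (frob F L) (frob F L).injective]

theorem exists_frob_iterate_eq (hμ : Irreducible μ) (hx : aeval x μ = 0) (hy : aeval y μ = 0) :
    ∃ k < μ.natDegree, (frob F L)^[k] x = y := by
  have h := (mem_rootSet_minpoly_iff hμ hx).2 hy
  rw [rootSet_minpoly_eq] at h
  obtain ⟨k, hk, rfl⟩ := h
  exact ⟨k, by rw [natDegree_eq_minimalPeriod hμ hx]; exact hk, rfl⟩

theorem mod_natDegree_eq (hμ : Irreducible μ) (hx : aeval x μ = 0) {k n : ℕ}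
    (hn : n < μ.natDegree) (h : (frob F L)^[k] x = (frob F L)^[n] x) : k % μ.natDegree = n := by
  rw [natDegree_eq_minimalPeriod hμ hx] at hn ⊢
  refine Function.iterate_injOn_Iio_minimalPeriod (f := frob F L) (x := x)
    (Nat.mod_lt k (minimalPeriod_frob_pos F x)) hn ?_
  exact Function.iterate_mod_minimalPeriod_eq.trans h

theorem ncard_aeval_eq_zero (hμ : Irreducible μ) (hx : aeval x μ = 0) :
    {y : L | aeval y μ = 0}.ncard = μ.natDegree := by
  rw [natDegree_eq_minimalPeriod hμ hx, minimalPeriod_frob, ← ncard_rootSet_minpoly]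
  congr 1
  ext y
  exact (mem_rootSet_minpoly_iff hμ hx).symm

end Frobenius

theorem sigma_iterate_apply (F₀ : Type*) {L : Type*} [Field F₀] [Fintype F₀] [Field L]
    [Algebra F₀ L] (s k : ℕ) (x : L) :
    (sigma F₀ s L)^[k] x = x ^ (Fintype.card F₀ ^ s) ^ k := by
  have : ⇑(sigma F₀ s L) = fun x => x ^ (Fintype.card F₀ ^ s) := funext (sigma_apply F₀ s L)
  rw [this, pow_iterate]

section FiniteFields

variable {F₀ F Fq L : Type*} [Field F₀] [Fintype F₀] [Field F] [Fintype F] [Field Fq] [Fintype Fq]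
  [Field L] [Finite L] [Algebra F₀ F] [Algebra F₀ L] [Algebra F L] [Algebra Fq L]

theorem isCSCExtension_sigma {s ℓ : ℕ} (hcard : Fintype.card Fq = Fintype.card F₀ ^ s)
    (hℓ : 0 < ℓ) (hdvd : ℓ ∣ Fintype.card Fq - 1) {a : L} (ha : IsPrimitiveRoot a ℓ) :
    IsCSCExtension Fq (sigma F₀ s F) (sigma F₀ s L) (frob F L) ℓ (Module.finrank Fq L) := by
  have hσ : ∀ k x, (sigma F₀ s L)^[k] x = (frob Fq L)^[k] x := fun k x => by
    rw [sigma_iterate_apply, frob_iterate_apply, hcard]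
  refine
    { ell_pos := hℓ
      pos := Module.finrank_pos
      map_sigma := fun x => by rw [sigma_apply, sigma_apply, _root_.map_pow]
      comm := fun x => by rw [sigma_apply, sigma_apply, _root_.map_pow]
      generates := exists_eq_frob_pow F
      fixed_tau := fun x hx => (pow_card_eq_self_iff F x).1 hx
      fixed_sigma := fun x => by rw [sigma_apply, ← hcard, pow_card_eq_self_iff]
      sigma_iterate := fun x => by rw [hσ, frob_iterate_finrank]
      sigma_order := fun k hk h => ?_
      finrank_eq := rfl
      root_fixed := fun α hα => ?_
      exists_root := ⟨a, ha⟩ }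
  · have h1 : frob Fq L ^ k = 1 := AlgEquiv.ext fun x => by
      rw [AlgEquiv.coe_pow, ← hσ, h]; rfl
    have h2 := orderOf_dvd_of_pow_eq_one h1
    rw [FiniteField.orderOf_frobeniusAlgEquivOfAlgebraic] at h2
    exact Nat.eq_zero_of_dvd_of_lt h2 hk
  · obtain ⟨c, hc⟩ := hdvd
    rw [sigma_apply, ← hcard, ← Nat.sub_add_cancel (Fintype.card_pos (α := Fq)), hc, pow_succ,
      pow_mul, hα, one_pow, one_mul]

end FiniteFields

/-! ### The conjugates of the zeros of a sum-rank BCH code -/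

theorem mem_srBCHCode_iff {F L : Type*} [Field F] [Field L] [Algebra F L] {σL : L →+* L} {ℓ m : ℕ}
    {a : L} (hσ : σL a = a) (δ b : ℕ) (β : L) (c : Fin ℓ × Fin m → F) :
    c ∈ srBCHCode F σL ℓ m δ b a β ↔
      ∀ k, k + 2 ≤ δ →
        codeEval σL (a ^ (b + k)) (fun ij => algebraMap F L (c ij)) (σL^[k] β) = 0 := by
  have hpow : ∀ k n : ℕ, σL^[k] (a ^ n) = a ^ n := fun k n =>
    Function.iterate_fixed (by rw [_root_.map_pow, hσ]) k
  have hrow : ∀ t : Fin (δ - 1), (linRSMatrix σL (δ - 1) (fun i : Fin ℓ => a ^ (i : ℕ))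
      fun (i : Fin ℓ) (j : Fin m) => σL^[j] β * a ^ (b * i)).row t ⬝ᵥ
        (fun ij => algebraMap F L (c ij)) =
      codeEval σL (a ^ (b + t)) (fun ij => algebraMap F L (c ij)) (σL^[t] β) := by
    intro t
    rw [dotProduct, Fintype.sum_prod_type_right, codeEval]
    refine Finset.sum_congr rfl fun j _ => ?_
    rw [Finset.sum_mul]
    refine Finset.sum_congr rfl fun i _ => ?_
    simp only [Matrix.row, linRSMatrix, Matrix.of_apply, linOp, iterate_map_mul, hpow,
      Finset.prod_const, Finset.card_range]
    rw [← Function.iterate_add_apply, ← Function.iterate_add_apply, add_comm (t : ℕ) j]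
    ring
  constructor
  · intro h k hk
    rw [← hrow ⟨k, by omega⟩]
    exact h _ (Submodule.subset_span ⟨_, rfl⟩)
  · intro h x hx
    induction hx using Submodule.span_induction with
    | mem x hx =>
      obtain ⟨t, rfl⟩ := hx
      rw [hrow]
      exact h t (by have := t.2; omega)
    | zero => exact zero_dotProduct _
    | add x y _ _ hx hy => rw [add_dotProduct, hx, hy, add_zero]
    | smul r x _ hx => rw [smul_dotProduct, hx, smul_zero]

section Conjugates

variable {Fq F L : Type*} [Field F] [Fintype F] [Field Fq] [Field L] [Finite L] [Algebra F L]
  [Algebra Fq L] {σ : F →+* F} {σL : L →+* L} {ℓ m : ℕ}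

/-- The `Fq`-span of the conjugates `τ ^ h (σ ^ k (β))` of the zeros `(a ^ (b + k), σ ^ k (β))`,
`k ≤ δ - 2`, of the code, over those `h` and `k` for which `τ ^ h (a ^ (b + k)) = α`, where
`τ : x ↦ x ^ |F|`. -/
def conjSpan (Fq F : Type*) {L : Type*} [Field F] [Fintype F] [Field Fq] [Field L] [Finite L]
    [Algebra F L] [Algebra Fq L] (σL : L →+* L) (δ b : ℕ) (a β : L) (α : L) : Submodule Fq L :=
  Submodule.span Fq {y | ∃ k h : ℕ, k + 2 ≤ δ ∧ (frob F L)^[h] (a ^ (b + k)) = α ∧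
    y = (frob F L)^[h] (σL^[k] β)}

theorem frob_mem_conjSpan [Fintype Fq] (δ b : ℕ) (a β : L) {α x : L}
    (hx : x ∈ conjSpan Fq F σL δ b a β α) :
    frob F L x ∈ conjSpan Fq F σL δ b a β (frob F L α) := by
  induction hx using Submodule.span_induction with
  | mem x h =>
    obtain ⟨k, h, hk, hα, rfl⟩ := h
    exact Submodule.subset_span ⟨k, h + 1, hk, by rw [Function.iterate_succ_apply', hα],
      by rw [Function.iterate_succ_apply']⟩
  | zero => rw [_root_.map_zero]; exact Submodule.zero_mem _
  | add x y _ _ hx hy => rw [_root_.map_add]; exact Submodule.add_mem _ hx hy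
  | smul c x _ hx =>
    have : frob F L (c • x) = (c ^ Fintype.card F) • frob F L x := by
      rw [Algebra.smul_def, Algebra.smul_def, _root_.map_mul, _root_.map_pow]
      rfl
    rw [this]
    exact Submodule.smul_mem _ _ hx

/-- The converse of `frob_mem_conjSpan` holds because the Frobenius automorphism has finite
order. -/
theorem isEquivariant_conjSpan [Fintype Fq] (δ b : ℕ) (a β : L) :
    IsCSCExtension.IsEquivariant (frob F L) ℓ (conjSpan Fq F σL δ b a β) := by
  refine fun α _ x => ⟨fun hx => ?_, frob_mem_conjSpan δ b a β⟩
  have key : ∀ n (α x : L), x ∈ conjSpan Fq F σL δ b a β α →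
      (frob F L)^[n] x ∈ conjSpan Fq F σL δ b a β ((frob F L)^[n] α) := by
    intro n α x hx
    induction n with
    | zero => exact hx
    | succ n ih =>
      rw [Function.iterate_succ_apply', Function.iterate_succ_apply']
      exact frob_mem_conjSpan δ b a β ih
  have hn : Module.finrank F L - 1 + 1 = Module.finrank F L :=
    Nat.sub_add_cancel Module.finrank_pos
  have := key (Module.finrank F L - 1) _ _ hx
  rwa [← Function.iterate_succ_apply, ← Function.iterate_succ_apply, Nat.succ_eq_add_one, hn,
    frob_iterate_finrank, frob_iterate_finrank] at this

/-- Applying powers of `τ` to the parity checks shows that a sum-rank BCH code consists of the words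
that vanish on all conjugates of its zeros, hence on their `Fq`-spans. -/
theorem isVanishingCode_srBCHCode (H : IsCSCExtension Fq σ σL (frob F L) ℓ m) {a : L}
    (ha : a ^ ℓ = 1) (δ b : ℕ) (β : L) :
    IsVanishingCode σL (conjSpan Fq F σL δ b a β) (srBCHCode F σL ℓ m δ b a β) := by
  intro c
  rw [mem_srBCHCode_iff (H.root_fixed a ha)]
  constructor
  · intro h α hα x hx
    rw [← op_evalRoot_codePoly (σ := σ) hα]
    induction hx using Submodule.span_induction with
    | mem x hx =>
      obtain ⟨k, n, hk, hα', rfl⟩ := hx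
      rw [op_evalRoot_codePoly, ← hα']
      have key : ∀ n (α x : L), codeEval σL ((frob F L)^[n] α) (fun ij => algebraMap F L (c ij))
          ((frob F L)^[n] x) =
            (frob F L)^[n] (codeEval σL α (fun ij => algebraMap F L (c ij)) x) := by
        intro n α x
        induction n with
        | zero => rfl
        | succ n ih =>
          rw [Function.iterate_succ_apply', Function.iterate_succ_apply',
            Function.iterate_succ_apply', ← ih, ← codeEval_map H.comm]
          simp only [AlgEquiv.commutes]
      rw [key, h k hk, iterate_map_zero]
    | zero => exact _root_.map_zero _
    | add x y _ _ hx hy => rw [_root_.map_add, hx, hy, add_zero]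
    | smul r x _ hx =>
      rw [SkewPoly.op_smul (fun y => (H.fixed_sigma _).2 ⟨y, rfl⟩), hx, smul_zero]
  · intro h k hk
    exact h _ (by rw [← pow_mul, mul_comm, pow_mul, ha, one_pow]) _
      (Submodule.subset_span ⟨k, 0, hk, rfl, rfl⟩)

end Conjugates

/-! ### The factors of `x ^ ℓ - 1` -/

section Factors

/-- Over a field that contains the `ℓ`th roots of unity, a sum over these is a sum over the zeros of
the irreducible factors of `x ^ ℓ - 1`. -/
theorem sum_nthRootsFinset {F L : Type*} [Field F] [Field L] [Algebra F L] {ℓ t : ℕ} (hℓ : 0 < ℓ)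
    (hsep : (X ^ ℓ - 1 : F[X]).Separable) {μ : Fin t → F[X]}
    (hprod : (X ^ ℓ - 1 : F[X]) = ∏ i, μ i) (f : L → ℕ) (v : Fin t → ℕ)
    (hf : ∀ i α, aeval α (μ i) = 0 → f α = v i)
    (hcard : ∀ i, {α : L | aeval α (μ i) = 0}.ncard = (μ i).natDegree) :
    ∑ α ∈ nthRootsFinset ℓ (1 : L), f α = ∑ i, (μ i).natDegree * v i := by
  classical
  have hroot : ∀ α : L, α ^ ℓ = 1 ↔ ∃ i, aeval α (μ i) = 0 := by
    intro α
    have h1 : aeval α (X ^ ℓ - 1 : F[X]) = ∏ i, aeval α (μ i) := by rw [hprod, map_prod]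
    have h2 : aeval α (X ^ ℓ - 1 : F[X]) = α ^ ℓ - 1 := by simp
    rw [← sub_eq_zero, ← h2, h1, Finset.prod_eq_zero_iff]
    simp
  have huniq : ∀ (α : L) i j, aeval α (μ i) = 0 → aeval α (μ j) = 0 → i = j := by
    intro α i j hi hj
    by_contra hij
    have hdvd : μ i * μ j ∣ X ^ ℓ - 1 := by
      rw [hprod, ← Finset.mul_prod_erase _ _ (Finset.mem_univ i)]
      exact mul_dvd_mul_left _ (Finset.dvd_prod_of_mem _ (by simp [Ne.symm hij]))
    obtain ⟨u, w, huw⟩ := (hsep.of_dvd hdvd).isCoprime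
    have := congrArg (aeval α) huw
    rw [_root_.map_add, _root_.map_mul, _root_.map_mul, hi, hj, mul_zero, mul_zero, add_zero,
      _root_.map_one] at this
    exact zero_ne_one this
  have hbij : ∀ i, ∑ α ∈ (nthRootsFinset ℓ (1 : L)).filter (fun α => aeval α (μ i) = 0), f α =
      (μ i).natDegree * v i := by
    intro i
    rw [Finset.sum_congr rfl fun α hα => hf i α (Finset.mem_filter.1 hα).2, Finset.sum_const,
      smul_eq_mul, ← hcard i, ← Set.ncard_coe_finset]
    congr 2
    ext α
    simp only [Finset.coe_filter, Set.mem_ofPred_eq, mem_nthRootsFinset hℓ]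
    exact ⟨fun h => h.2, fun h => ⟨(hroot α).2 ⟨i, h⟩, h⟩⟩
  simp_rw [← hbij, Finset.sum_filter]
  rw [Finset.sum_comm]
  refine Finset.sum_congr rfl fun α hα => ?_
  obtain ⟨i, hi⟩ := (hroot α).1 ((mem_nthRootsFinset hℓ 1).1 hα)
  rw [Finset.sum_eq_single i, if_pos hi]
  · intro j _ hj
    exact if_neg fun h => hj (huniq α j i h hi)
  · simp

end Factors

section Span

theorem frobSpan_eq_bot {Fq L : Type*} [Field Fq] [Field L] [Algebra Fq L] {β : L}
    {J : Set ℕ} (hJ : ¬ J.Nonempty) (q₀ s m d : ℕ) (h : ℕ → ℕ) :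
    frobSpan Fq q₀ s m d J h β = ⊥ := by
  rw [frobSpan, Submodule.span_eq_bot]
  rintro _ ⟨j, hj, -⟩
  exact absurd ⟨j, hj⟩ hJ

variable {Fq F L : Type*} [Field F] [Fintype F] [Field Fq] [Field L] [Finite L] [Algebra F L]
  [Algebra Fq L] {σL : L →+* L} {δ b : ℕ} {a β : L}

theorem mem_rootIndices_of_frob_iterate {μ : F[X]} {α : L} (hα : aeval α μ = 0) {k h : ℕ}
    (hk : k + 2 ≤ δ) (hkα : (frob F L)^[h] (a ^ (b + k)) = α) :
    k ∈ rootIndices μ δ b a :=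
  ⟨hk, (aeval_frob_iterate h).1 (by rw [hkα]; exact hα)⟩

theorem conjSpan_eq_bot {μ : F[X]} (hJ : ¬ (rootIndices μ δ b a).Nonempty) {α : L}
    (hα : aeval α μ = 0) : conjSpan Fq F σL δ b a β α = ⊥ := by
  rw [conjSpan, Submodule.span_eq_bot]
  rintro _ ⟨k, h, hk, hkα, -⟩
  exact absurd ⟨k, mem_rootIndices_of_frob_iterate hα hk hkα⟩ hJ

/-- The span over the exponents `v = s j + m (u d + h_j) mod s m` is the span of all the conjugates
of the zeros that lie over `α`: `τ ^ h` maps `a ^ (b + j)` to `α` exactly when `h ≡ h_j` modulo the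
size `d` of the orbit, and `u` runs over these `h` modulo the order `s` of `τ`. -/
theorem frobSpan_eq_conjSpan {q₀ s m : ℕ} (hs : 0 < s) (hF : Fintype.card F = q₀ ^ m)
    (hL : ∀ x : L, x ^ q₀ ^ (s * m) = x) (hsL : Module.finrank F L = s)
    (hσ : ∀ k x, σL^[k] x = x ^ q₀ ^ (s * k)) {μ : F[X]} (hμ : Irreducible μ) {α : L}
    (hα : aeval α μ = 0) (h : ℕ → ℕ)
    (hh : ∀ j ∈ rootIndices μ δ b a,
      h j < μ.natDegree ∧ (frob F L)^[h j] (a ^ (b + j)) = α) :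
    frobSpan Fq q₀ s m μ.natDegree (rootIndices μ δ b a) h β =
      conjSpan Fq F σL δ b a β α := by
  have hd : μ.natDegree ∣ s := hsL ▸ natDegree_dvd_finrank hμ hα
  have hdpos : 0 < μ.natDegree := natDegree_pos_iff_degree_pos.2 (degree_pos_of_irreducible hμ)
  have hmod : ∀ (x : L) n, x ^ q₀ ^ (n % (s * m)) = x ^ q₀ ^ n := by
    intro x n
    have hit : ∀ k (y : L), (fun y : L => y ^ q₀)^[k] y = y ^ q₀ ^ k := fun k y => by
      rw [pow_iterate]
    rw [← hit, ← hit]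
    exact Function.IsPeriodicPt.iterate_mod_apply (f := fun y : L => y ^ q₀)
      (by rw [Function.IsPeriodicPt, Function.IsFixedPt, hit, hL]) n
  have hval : ∀ j n, (frob F L)^[n] (σL^[j] β) = β ^ q₀ ^ ((s * j + m * n) % (s * m)) := by
    intro j n
    rw [hmod, frob_iterate_apply, hσ, hF, ← pow_mul, ← pow_mul, ← pow_add]
  apply le_antisymm
  · refine Submodule.span_le.2 ?_
    rintro _ ⟨j, hj, u, -, rfl⟩
    refine Submodule.subset_span ⟨j, u * μ.natDegree + h j, hj.1, ?_, (hval _ _).symm⟩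
    rw [Function.iterate_add_apply, (hh j hj).2, natDegree_eq_minimalPeriod hμ hα]
    exact (Function.isPeriodicPt_minimalPeriod _ α).const_mul u
  · refine Submodule.span_le.2 ?_
    rintro _ ⟨j, n, hj2, hjα, rfl⟩
    have hj := mem_rootIndices_of_frob_iterate hα hj2 hjα
    have hn : n % μ.natDegree = h j :=
      mod_natDegree_eq hμ hj.2 (hh j hj).1 (by rw [hjα, (hh j hj).2])
    refine Submodule.subset_span ⟨j, hj, n % s / μ.natDegree,
      Nat.div_lt_div_of_lt_of_dvd hd (Nat.mod_lt _ hs), ?_⟩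
    rw [← hval]
    have hns : n % s / μ.natDegree * μ.natDegree + h j = n % s := by
      rw [← hn, ← Nat.mod_mod_of_dvd n hd]
      exact Nat.div_add_mod' _ _
    rw [hns, ← hsL]
    exact (Function.IsPeriodicPt.iterate_mod_apply (frob_iterate_finrank F _) n).symm

theorem frob_iterate_pow_eq_iff {q₀ m ℓ : ℕ} (hℓ : 0 < ℓ) (hF : Fintype.card F = q₀ ^ m)
    (ha : IsPrimitiveRoot a ℓ) (h i j : ℕ) :
    (frob F L)^[h] (a ^ i) = a ^ j ↔ j ≡ i * q₀ ^ (h * m) [MOD ℓ] := by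
  have hfin : IsOfFinOrder a := isOfFinOrder_iff_pow_eq_one.2 ⟨ℓ, hℓ, ha.pow_eq_one⟩
  rw [frob_iterate_apply, hF, ← pow_mul, ← pow_mul, mul_comm m h, hfin.pow_eq_pow_iff_modEq,
    ← ha.eq_orderOf]
  exact ⟨Nat.ModEq.symm, Nat.ModEq.symm⟩

theorem finrank_conjSpan_frob_iterate [Fintype Fq] {σ : F →+* F} {ℓ m : ℕ}
    (H : IsCSCExtension Fq σ σL (frob F L) ℓ m) (k : ℕ) {α : L} (hα : α ^ ℓ = 1) :
    Module.finrank Fq (conjSpan Fq F σL δ b a β ((frob F L)^[k] α)) =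
      Module.finrank Fq (conjSpan Fq F σL δ b a β α) := by
  induction k with
  | zero => rfl
  | succ k ih =>
    rw [Function.iterate_succ_apply', H.finrank_equivariant (isEquivariant_conjSpan δ b a β), ih]
    rw [← AlgEquiv.coe_pow, ← _root_.map_pow, hα, _root_.map_one]

end Span

end SumRankBCH

open SumRankBCH
theorem mainTheorem3
    {F₀ F Fq L : Type*} [Field F₀] [Fintype F₀] [Field F] [Field Fq] [Field L]
    [Algebra F₀ F] [Algebra F₀ Fq] [Algebra F₀ L] [Algebra F L] [Algebra Fq L]
    [IsScalarTower F₀ F L] [IsScalarTower F₀ Fq L]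
    (q₀ q m s ℓ : ℕ) (hm : 0 < m) (hs : 0 < s) (hℓ : 0 < ℓ)
    (hq₀ : Fintype.card F₀ = q₀) (hq : q = q₀ ^ s)
    (hF : Module.finrank F₀ F = m) (hFq : Module.finrank F₀ Fq = s)
    (hL : Module.finrank Fq L = m)
    (hℓm : ℓ.Coprime m) (hℓq : ℓ.Coprime q) (hℓq1 : ℓ ∣ q - 1)
    (a : Fq) (ha : IsPrimitiveRoot a ℓ)
    (β : L) (hβ : IsNormalElement Fq (sigma F₀ s L) m β)
    (b δ : ℕ) (hδ : 2 ≤ δ) (hδn : δ ≤ ℓ * m)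
    (t : ℕ) (μ : Fin t → Polynomial F) (hμ : ∀ i, Irreducible (μ i))
    (hprod : (Polynomial.X ^ ℓ - 1 : Polynomial F) = ∏ i, μ i)
    (J : Fin t → Set ℕ) (hJ : ∀ i, J i = rootIndices (μ i) δ b (algebraMap Fq L a))
    (j' : Fin t → ℕ) (hj' : ∀ i, (J i).Nonempty → j' i ∈ J i)
    (𝒞 : Submodule F (Fin ℓ × Fin m → F))
    (h𝒞 : 𝒞 = srBCHCode F (sigma F₀ s L) ℓ m δ b (algebraMap Fq L a) β) :
    (∃ h : Fin t → ℕ → ℕ, ∀ i, ∀ j ∈ J i,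
      h i j < (μ i).natDegree ∧ b + j' i ≡ (b + j) * q₀ ^ (h i j * m) [MOD ℓ]) ∧
    (∀ i, (μ i).natDegree ∣ s) ∧
    IsCSC (sigma F₀ s F) 𝒞 ∧
    (∃! g, IsMinimalGenerator (sigma F₀ s F) 𝒞 g) ∧
    ∀ h : Fin t → ℕ → ℕ,
      (∀ i, ∀ j ∈ J i,
        h i j < (μ i).natDegree ∧ b + j' i ≡ (b + j) * q₀ ^ (h i j * m) [MOD ℓ]) →
      (∀ i, (J i).Nonempty →
        partialDefiningSet L (sigma F₀ s F) (sigma F₀ s L) 𝒞 (a ^ (b + j' i)) =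
          (frobSpan Fq q₀ s m (μ i).natDegree (J i) (h i) β : Set L) \ {0}) ∧
      (Module.finrank F 𝒞 : ℤ) = ((ℓ * m : ℕ) : ℤ) - ∑ i, ((μ i).natDegree : ℤ) *
        (Module.finrank Fq (frobSpan Fq q₀ s m (μ i).natDegree (J i) (h i) β) : ℤ) := by
  obtain rfl : J = fun i => rootIndices (μ i) δ b (algebraMap Fq L a) := funext hJ
  have : FiniteDimensional F₀ F := FiniteDimensional.of_finrank_pos (by omega)
  have : FiniteDimensional F₀ Fq := FiniteDimensional.of_finrank_pos (by omega)
  have : FiniteDimensional Fq L := FiniteDimensional.of_finrank_pos (by omega)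
  have : Finite F := Module.finite_of_finite F₀
  have : Finite Fq := Module.finite_of_finite F₀
  have : Finite L := Module.finite_of_finite Fq
  have := Fintype.ofFinite F
  have := Fintype.ofFinite Fq
  have := Fintype.ofFinite L
  have hcF : Fintype.card F = q₀ ^ m := by
    rw [Module.card_eq_pow_finrank (K := F₀), hq₀, hF]
  have hcFq : Fintype.card Fq = q₀ ^ s := by
    rw [Module.card_eq_pow_finrank (K := F₀), hq₀, hFq]
  have hcL : Fintype.card L = q₀ ^ (s * m) := by
    rw [Module.card_eq_pow_finrank (K := Fq), hcFq, hL, pow_mul]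
  have hsL : Module.finrank F L = s := by
    have h1 := Module.finrank_mul_finrank F₀ F L
    rw [← Module.finrank_mul_finrank F₀ Fq L, hF, hFq, hL, mul_comm s] at h1
    exact Nat.eq_of_mul_eq_mul_left hm h1
  set A := algebraMap Fq L a with hA
  have haL : IsPrimitiveRoot A ℓ := ha.map_of_injective (algebraMap Fq L).injective
  have hpow : ∀ n, (A ^ n) ^ ℓ = 1 := fun n => by
    rw [← pow_mul, mul_comm, pow_mul, haL.pow_eq_one, one_pow]
  have H : IsCSCExtension Fq (sigma F₀ s F) (sigma F₀ s L) (frob F L) ℓ m := by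
    rw [← hL]
    exact isCSCExtension_sigma (by rw [hcFq, hq₀]) hℓ (by rwa [hcFq, ← hq]) haL
  have hW := isEquivariant_conjSpan (Fq := Fq) (F := F) (σL := sigma F₀ s L) (ℓ := ℓ) δ b A β
  have hD : IsVanishingCode (sigma F₀ s L) (conjSpan Fq F (sigma F₀ s L) δ b A β) 𝒞 :=
    h𝒞 ▸ isVanishingCode_srBCHCode H haL.pow_eq_one δ b β
  have hdvd : ∀ i, μ i ∣ X ^ ℓ - 1 := fun i => hprod ▸ Finset.dvd_prod_of_mem μ (Finset.mem_univ i)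
  refine ⟨?_, fun i => ?_, H.isCSC hD, ?_, fun h hh => ?_⟩
  · have hex : ∀ i j, ∃ k, j ∈ rootIndices (μ i) δ b A →
        k < (μ i).natDegree ∧ b + j' i ≡ (b + j) * q₀ ^ (k * m) [MOD ℓ] := by
      intro i j
      by_cases hj : j ∈ rootIndices (μ i) δ b A
      · obtain ⟨k, hk, hkα⟩ := exists_frob_iterate_eq (hμ i) hj.2 (hj' i ⟨j, hj⟩).2
        exact ⟨k, fun _ => ⟨hk, (frob_iterate_pow_eq_iff hℓ hcF haL _ _ _).1 hkα⟩⟩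
      · exact ⟨0, fun h => absurd h hj⟩
    choose h hh using hex
    exact ⟨h, hh⟩
  · obtain ⟨α, -, hα⟩ := H.exists_root_of_dvd (hdvd i) (hμ i)
    exact hsL ▸ natDegree_dvd_finrank (hμ i) hα
  · obtain ⟨g, hg, huniq, -⟩ := H.existsUnique_isMinimalGenerator hW hD
    exact ⟨g, hg, huniq⟩
  · have hspan : ∀ i, (rootIndices (μ i) δ b A).Nonempty →
        frobSpan Fq q₀ s m (μ i).natDegree (rootIndices (μ i) δ b A) (h i) β =
          conjSpan Fq F (sigma F₀ s L) δ b A β (A ^ (b + j' i)) := fun i hi =>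
      frobSpan_eq_conjSpan hs hcF (fun x => by rw [← hcL, FiniteField.pow_card]) hsL
        (fun k x => by rw [sigma_iterate_apply, hq₀, pow_mul]) (hμ i) (hj' i hi).2 (h i)
        fun j hj => ⟨(hh i j hj).1, (frob_iterate_pow_eq_iff hℓ hcF haL _ _ _).2 (hh i j hj).2⟩
    refine ⟨fun i hi => ?_, ?_⟩
    · rw [hspan i hi, H.partialDefiningSet_eq hW hD (by rw [_root_.map_pow]; exact hpow _),
        _root_.map_pow]
    · have hℓF : (ℓ : F) ≠ 0 := by
        have : NeZero ℓ := ⟨hℓ.ne'⟩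
        have := haL.neZero'
        intro h0
        exact NeZero.ne (ℓ : L) (by rw [← map_natCast (algebraMap F L), h0, _root_.map_zero])
      have hsum := sum_nthRootsFinset hℓ (X_pow_sub_one_separable_iff.2 hℓF) hprod
        (fun α : L => Module.finrank Fq (conjSpan Fq F (sigma F₀ s L) δ b A β α))
        (fun i => Module.finrank Fq
          (frobSpan Fq q₀ s m (μ i).natDegree (rootIndices (μ i) δ b A) (h i) β))
        (fun i α hα => by
          by_cases hi : (rootIndices (μ i) δ b A).Nonempty
          · obtain ⟨k, -, rfl⟩ := exists_frob_iterate_eq (hμ i) (hj' i hi).2 hα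
            rw [hspan i hi, finrank_conjSpan_frob_iterate H k (hpow _)]
          · rw [conjSpan_eq_bot hi hα, frobSpan_eq_bot hi])
        (fun i => by
          obtain ⟨α, -, hα⟩ := H.exists_root_of_dvd (hdvd i) (hμ i)
          exact ncard_aeval_eq_zero (hμ i) hα)
      have hfin := H.finrank_add_sum hW hD
      rw [hsum] at hfin
      rw [← hfin]
      push_cast
      ring
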